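/- Let $R$ be a commutative ring, $H$ a Hopf algebra over $R$ with antipode $S$, counit $\varepsilon$ and comultiplication $\Delta(h)=\sum h_1\otimes h_2$, and let $A$ be a left $H$-module algebra (an associative unital $R$-algebra that is a left $H$-module with $h(ab)=\sum (h_1a)(h_2b)$ and $h1_A=\varepsilon(h)1_A$). Assume that $A$ is $H$-semiprime, i.e. $A$ has no non-zero nilpotent $H$-stable two-sided ideals, and that at least one of the following holds: $A$ is commutative; $A$ is semiprime (it has no non-zero nilpotent two-sided ideals); the antipode of $H$ is bijective. Let $M_H(A)\subseteq \mathrm{End}_R(A)$ be the subring generated by all left and right multiplications by elements of $A$ and by the action of all elements of $H$. Let $E(A)$ be the injective hull of the left $M_H(A)$-module $A$, let $\widehat A\supseteq A$ be the self-injective hull of $A$, i.e. the largest $A$-generated $M_H(A)$-submodule of $E(A)$, and let $T=\mathrm{End}_{M_H(A)}(\widehat A)$. Let $\mathcal F_H$ be the set of $H$-stable two-sided ideals of $A$ with zero left and zero right annihilator, and let $Q_0=\varinjlim_{I\in\mathcal F_H}\mathrm{Hom}_{-A}(I,A)$ be the right Martindale ring of quotients in the sense of Cohen: its elements are the classes $[f:I\to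 A]$ of right $A$-linear maps with $I\in\mathcal F_H$, two maps being identified if they agree on some $K\in\mathcal F_H$ contained in both domains; for $f:I\to A$ and $g:J\to A$ put $[f]+[g]=[f+g:I\cap J\to A]$ and $[f][g]=[f\circ g:JI\to A]$; and $H$ acts on $Q_0$ by $h\cdot[f:I\to A]=[x\mapsto\sum h_1f(S(h_2)x)]$. Let $Z(Q_0)^H=\{q\in Z(Q_0)\mid h\cdot q=\varepsilon(h)q \text{ for all } h\in H\}$. For $f\in T$ put $I_f=f^{-1}(A)\cap A$. Then $I_f\in\mathcal F_H$ for every $f\in T$, and $$\psi:T\to Z(Q_0)^H,\qquad f\mapsto [f|_{I_f}:I_f\to A]$$ is an isomorphism of rings. Moreover, the (commutative) ring $Z(Q_0)^H$ is von Neumann regular and self-injective. -/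

import Mathlib

universe w v u

noncomputable section

open scoped TensorProduct

namespace HopfAction

set_option linter.unusedSectionVars false

/-! ### Sweedler sums and module algebras -/

section Sweedler

variable {R : Type w} [CommRing R] {H : Type v} [Ring H] [HopfAlgebra R H]
  {M : Type*} [AddCommGroup M] [Module R M]

/-- The Sweedler sum `h ↦ ∑ B h₁ h₂` of a bilinear map `B`, where `Δ h = ∑ h₁ ⊗ h₂`. -/
def sweedler (B : H →ₗ[R] H →ₗ[R] M) : H →ₗ[R] M :=
  TensorProduct.lift B ∘ₗ Coalgebra.comul

theorem sweedler_repr (B : H →ₗ[R] H →ₗ[R] M) {h : H} {ι : Type*} (r : Coalgebra.Repr R h ι) :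
    sweedler B h = ∑ i ∈ r.index, B (r.left i) (r.right i) := by
  simp [sweedler, ← r.eq]

/-- Coassociativity for Sweedler sums:
`∑ T (h₁)₁ (h₁)₂ h₂ = ∑ T h₁ (h₂)₁ (h₂)₂`. -/
theorem sweedler_assoc (T : H →ₗ[R] H →ₗ[R] H →ₗ[R] M) (B C : H →ₗ[R] H →ₗ[R] M)
    (hB : ∀ a c, B a c = sweedler (T.compr₂ (LinearMap.applyₗ c)) a)
    (hC : ∀ a c, C a c = sweedler (T a) c) (h : H) : sweedler B h = sweedler C h := by
  let r := Coalgebra.Repr.arbitrary R h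
  rw [sweedler_repr B r, sweedler_repr C r]
  have key := Coalgebra.sum_tmul_tmul_eq r
    (fun i => Coalgebra.Repr.arbitrary R (r.left i)) (fun i => Coalgebra.Repr.arbitrary R (r.right i))
  have key2 := congrArg (TensorProduct.lift (TensorProduct.uncurry (.id R) H H M ∘ₗ T)) key
  simp only [map_sum, TensorProduct.lift.tmul, LinearMap.comp_apply,
    TensorProduct.uncurry_apply] at key2
  simp only [hB, hC, sweedler_repr _ (Coalgebra.Repr.arbitrary R (_ : H))]
  simpa using key2

end Sweedler

/-- The orbit map `h ↦ h • a`. -/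
def orbitMap (R : Type w) [CommRing R] (H : Type v) [Ring H] [Algebra R H]
    {A : Type u} [AddCommGroup A] [Module R A] [Module H A] [IsScalarTower R H A] (a : A) :
    H →ₗ[R] A where
  toFun h := h • a
  map_add' g h := add_smul g h a
  map_smul' r h := smul_assoc r h a

@[simp]
theorem orbitMap_apply (R : Type w) [CommRing R] (H : Type v) [Ring H] [Algebra R H]
    {A : Type u} [AddCommGroup A] [Module R A] [Module H A] [IsScalarTower R H A] (a : A) (h : H) :
    orbitMap R H a h = h • a := rfl

/-- `A` is a left `H`-module algebra: an `R`-algebra and a left `H`-module (with the same underlying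
`R`-module) such that `h • (a * b) = ∑ (h₁ • a) * (h₂ • b)` and `h • 1 = ε(h) • 1`. -/
class HopfModuleAlgebra (R : Type w) [CommRing R] (H : Type v) [Ring H] [HopfAlgebra R H]
    (A : Type u) [Ring A] [Algebra R A] [Module H A] [IsScalarTower R H A] : Prop where
  smul_mul : ∀ (h : H) (a b : A),
    h • (a * b) = sweedler ((LinearMap.mul R A).compl₁₂ (orbitMap R H a) (orbitMap R H b)) h
  smul_one : ∀ h : H, h • (1 : A) = (Coalgebra.counit h : R) • (1 : A)

section Antipode

variable {R : Type w} [CommRing R] {H : Type v} [Ring H] [HopfAlgebra R H]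

open WithConv in
/-- The antipode is an anti-coalgebra map: `Δ (S h) = ∑ S h₂ ⊗ S h₁`. -/
theorem comul_antipode (h : H) :
    Coalgebra.comul (R := R) (HopfAlgebra.antipode R h) =
      sweedler ((TensorProduct.mk R H H).flip.compl₁₂
        (HopfAlgebra.antipode R) (HopfAlgebra.antipode R)) h := by
  let δ : H →ₗ[R] H ⊗[R] H := Coalgebra.comul
  let S : H →ₗ[R] H := HopfAlgebra.antipode R
  let iL : H →ₐ[R] H ⊗[R] H := Algebra.TensorProduct.includeLeft
  let iR : H →ₐ[R] H ⊗[R] H := Algebra.TensorProduct.includeRight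
  have hδ : toConv δ = toConv iL.toLinearMap * toConv iR.toLinearMap := by
    ext c
    rw [(Coalgebra.Repr.arbitrary R c).convMul_apply]
    simp [δ, iL, iR, (Coalgebra.Repr.arbitrary R c).eq]
  have hinv : ∀ i : H →ₐ[R] H ⊗[R] H,
      toConv (i.toLinearMap ∘ₗ S) * toConv i.toLinearMap = 1 := by
    intro i
    ext c
    rw [(Coalgebra.Repr.arbitrary R c).convMul_apply]
    have := congrArg i
      (HopfAlgebra.sum_antipode_mul_eq_algebraMap_counit (Coalgebra.Repr.arbitrary R c))
    simpa [S] using this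
  have hG : (toConv (iR.toLinearMap ∘ₗ S) * toConv (iL.toLinearMap ∘ₗ S)) * toConv δ = 1 := by
    rw [hδ, mul_assoc, ← mul_assoc (toConv (iL.toLinearMap ∘ₗ S)), hinv, one_mul, hinv]
  have hF : toConv δ * toConv (δ ∘ₗ S) = 1 := LinearMap.comul_right_inv
  have := congrArg (fun f => f.ofConv h) (left_inv_eq_right_inv hG hF)
  simp only [(Coalgebra.Repr.arbitrary R h).convMul_apply] at this
  rw [sweedler_repr _ (Coalgebra.Repr.arbitrary R h)]
  simpa [iL, iR, S, δ] using this.symm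

end Antipode

section ModuleAlgebra

variable {R : Type w} [CommRing R] {H : Type v} [Ring H] [HopfAlgebra R H]
  {A : Type u} [Ring A] [Algebra R A] [Module H A] [IsScalarTower R H A]

/-- A two-sided ideal (every two-sided ideal of an `R`-algebra is an `R`-submodule). -/
def IsIdeal (I : Submodule R A) : Prop :=
  ∀ (a x : A), x ∈ I → a * x ∈ I ∧ x * a ∈ I

variable (H) in
/-- `I` is `H`-stable: `H • I ⊆ I`. -/
def IsStable (I : Submodule R A) : Prop :=
  ∀ (h : H) (x : A), x ∈ I → h • x ∈ I

variable (R A) in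
/-- `A` has no nonzero nilpotent two-sided ideals. -/
def IsSemiprimeAlgebra : Prop :=
  ∀ I : Submodule R A, IsIdeal I → IsNilpotent I → I = ⊥

variable (R H A) in
/-- `A` has no nonzero nilpotent `H`-stable two-sided ideals. -/
def IsHSemiprime : Prop :=
  ∀ I : Submodule R A, IsIdeal I → IsStable H I → IsNilpotent I → I = ⊥

variable (R H A) in
/-- The subring `M_H(A)` of `End_R(A)` generated by the left and right multiplications by elements
of `A` and by the action of the elements of `H`. -/
def multiplicationRing : Subring (Module.End R A) :=
  Subring.closure
    (Set.range (fun a : A => LinearMap.mulLeft R a) ∪ Set.range (fun a : A => LinearMap.mulRight R a) ∪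
      Set.range (fun h : H => Algebra.lsmul R R A h))

variable (R H A) in
/-- The filter of all `H`-stable two-sided ideals with zero left and right annihilator. -/
structure StableDenseIdeal where
  /-- the underlying submodule -/
  ideal : Submodule R A
  isIdeal : IsIdeal ideal
  isStable : IsStable H ideal
  left_annihilator : ∀ a : A, (∀ x ∈ ideal, a * x = 0) → a = 0
  right_annihilator : ∀ a : A, (∀ x ∈ ideal, x * a = 0) → a = 0

variable (R H A) in
/-- A right `A`-linear map `I → A` whose domain `I` is an `H`-stable two-sided ideal with zero left
and right annihilator (right `A`-linear maps are automatically `R`-linear). -/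
structure PartialHom where
  /-- the domain -/
  dom : StableDenseIdeal R H A
  /-- the map -/
  map : dom.ideal →ₗ[R] A
  map_mul : ∀ (x : dom.ideal) (a : A), map ⟨x * a, (dom.isIdeal a x x.2).2⟩ = map x * a

namespace StableDenseIdeal

/-- The intersection of two members of the filter. -/
def inf (I J : StableDenseIdeal R H A) : StableDenseIdeal R H A where
  ideal := I.ideal ⊓ J.ideal
  isIdeal a x hx := ⟨⟨(I.isIdeal a x hx.1).1, (J.isIdeal a x hx.2).1⟩,
    ⟨(I.isIdeal a x hx.1).2, (J.isIdeal a x hx.2).2⟩⟩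
  isStable h x hx := ⟨I.isStable h x hx.1, J.isStable h x hx.2⟩
  left_annihilator a ha := I.left_annihilator a fun x hx => J.left_annihilator _ fun y hy => by
    rw [mul_assoc]; exact ha _ ⟨(I.isIdeal y x hx).2, (J.isIdeal x y hy).1⟩
  right_annihilator a ha := J.right_annihilator a fun y hy => I.right_annihilator _ fun x hx => by
    rw [← mul_assoc]; exact ha _ ⟨(I.isIdeal y x hx).2, (J.isIdeal x y hy).1⟩

variable (R H A) in
/-- The whole algebra as a member of the filter. -/
def top : StableDenseIdeal R H A where
  ideal := ⊤
  isIdeal _ _ _ := ⟨trivial, trivial⟩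
  isStable _ _ _ := trivial
  left_annihilator a ha := by simpa using ha 1 trivial
  right_annihilator a ha := by simpa using ha 1 trivial

variable [HopfModuleAlgebra R H A]

theorem smul_mul_repr (h : H) (a b : A) {κ : Type*} (r : Coalgebra.Repr R h κ) :
    h • (a * b) = ∑ i ∈ r.index, (r.left i • a) * (r.right i • b) := by
  rw [HopfModuleAlgebra.smul_mul (R := R), sweedler_repr _ r]; rfl

/-- The product `I J` of two members of the filter. -/
def mul (I J : StableDenseIdeal R H A) : StableDenseIdeal R H A where
  ideal := I.ideal * J.ideal
  isIdeal a x hx := by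
    induction hx using Submodule.mul_induction_on' with
    | mem_mul_mem m hm n hn =>
      refine ⟨?_, ?_⟩
      · rw [← mul_assoc]
        exact Submodule.mul_mem_mul (I.isIdeal a m hm).1 hn
      · rw [mul_assoc]
        exact Submodule.mul_mem_mul hm (J.isIdeal a n hn).2
    | add x _ y _ hx hy =>
      rw [mul_add, add_mul]
      exact ⟨add_mem hx.1 hy.1, add_mem hx.2 hy.2⟩
  isStable h x hx := by
    induction hx using Submodule.mul_induction_on' with
    | mem_mul_mem m hm n hn =>
      rw [smul_mul_repr h m n (Coalgebra.Repr.arbitrary R h)]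
      exact sum_mem fun i _ => Submodule.mul_mem_mul (I.isStable _ m hm) (J.isStable _ n hn)
    | add x _ y _ hx hy =>
      rw [smul_add]
      exact add_mem hx hy
  left_annihilator a ha := I.left_annihilator a fun x hx => J.left_annihilator _ fun y hy => by
    rw [mul_assoc]; exact ha _ (Submodule.mul_mem_mul hx hy)
  right_annihilator a ha := J.right_annihilator a fun y hy => I.right_annihilator _ fun x hx => by
    rw [← mul_assoc]; exact ha _ (Submodule.mul_mem_mul hx hy)

end StableDenseIdeal


namespace PartialHom

/-- Two partial maps are equivalent if they agree on a member of the filter contained in both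
domains. -/
def Rel (f g : PartialHom R H A) : Prop :=
  ∃ K : StableDenseIdeal R H A, ∃ (hf : K.ideal ≤ f.dom.ideal) (hg : K.ideal ≤ g.dom.ideal),
    ∀ x (hx : x ∈ K.ideal), f.map ⟨x, hf hx⟩ = g.map ⟨x, hg hx⟩

theorem map_congr (f : PartialHom R H A) {x y : A} (hx : x ∈ f.dom.ideal) (hxy : x = y) :
    f.map ⟨x, hx⟩ = f.map ⟨y, hxy ▸ hx⟩ := by
  subst hxy; rfl

theorem rel_of_eq {f g : PartialHom R H A}
    (h : ∀ x (hf : x ∈ f.dom.ideal) (hg : x ∈ g.dom.ideal), f.map ⟨x, hf⟩ = g.map ⟨x, hg⟩) :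
    Rel f g :=
  ⟨f.dom.inf g.dom, inf_le_left, inf_le_right, fun x hx => h x hx.1 hx.2⟩

/-- Equivalent partial maps agree on the intersection of their domains. -/
theorem Rel.eq {f g : PartialHom R H A} (h : Rel f g) (x : A) (hf : x ∈ f.dom.ideal)
    (hg : x ∈ g.dom.ideal) : f.map ⟨x, hf⟩ = g.map ⟨x, hg⟩ := by
  obtain ⟨K, h1, h2, hK⟩ := h
  refine sub_eq_zero.1 (K.left_annihilator _ fun y hy => ?_)
  have e1 := f.map_mul ⟨x, hf⟩ y
  have e2 := g.map_mul ⟨x, hg⟩ y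
  have e3 := hK (x * y) (K.isIdeal x y hy).1
  rw [sub_mul, ← e1, ← e2]
  exact sub_eq_zero.2 e3

theorem Rel.trans {f g k : PartialHom R H A} (h1 : Rel f g) (h2 : Rel g k) : Rel f k :=
  ⟨(f.dom.inf k.dom).inf g.dom, inf_le_left.trans inf_le_left, inf_le_left.trans inf_le_right,
    fun x hx => (h1.eq x hx.1.1 hx.2).trans (h2.eq x hx.2 hx.1.2)⟩

variable (R H A) in
/-- The equivalence of partial maps. -/
instance setoid : Setoid (PartialHom R H A) where
  r := Rel
  iseqv :=
    { refl := fun _ => rel_of_eq fun _ _ _ => rfl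
      symm := fun ⟨K, h1, h2, h⟩ => ⟨K, h2, h1, fun x hx => (h x hx).symm⟩
      trans := Rel.trans }

/-- The sum of two partial maps, defined on the intersection of the domains. -/
def add (f g : PartialHom R H A) : PartialHom R H A where
  dom := f.dom.inf g.dom
  map := f.map ∘ₗ Submodule.inclusion inf_le_left + g.map ∘ₗ Submodule.inclusion inf_le_right
  map_mul x a := by
    have e1 := f.map_mul ⟨x, x.2.1⟩ a
    have e2 := g.map_mul ⟨x, x.2.2⟩ a
    exact (congrArg₂ (· + ·) e1 e2).trans (add_mul _ _ _).symm

/-- The negative of a partial map. -/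
def neg (f : PartialHom R H A) : PartialHom R H A where
  dom := f.dom
  map := -f.map
  map_mul x a := by simp [f.map_mul]

/-- The multiple of a partial map by a scalar in `R`. -/
def rsmul (r : R) (f : PartialHom R H A) : PartialHom R H A where
  dom := f.dom
  map := r • f.map
  map_mul x a := by simp [f.map_mul]

variable (R H A) in
/-- The zero map. -/
def zero : PartialHom R H A where
  dom := StableDenseIdeal.top R H A
  map := 0
  map_mul x a := by simp

variable (R H A) in
/-- The identity map. -/
def one : PartialHom R H A where
  dom := StableDenseIdeal.top R H A
  map := Submodule.subtype _
  map_mul _ _ := rfl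

section

variable [HopfModuleAlgebra R H A]

theorem mul_le_dom (f g : PartialHom R H A) : (g.dom.mul f.dom).ideal ≤ g.dom.ideal :=
  Submodule.mul_le.2 fun m hm n _ => (g.dom.isIdeal n m hm).2

theorem map_mem_dom (f g : PartialHom R H A) (x : A) (hx : x ∈ (g.dom.mul f.dom).ideal) :
    g.map ⟨x, mul_le_dom f g hx⟩ ∈ f.dom.ideal := by
  have : (g.dom.mul f.dom).ideal ≤ (f.dom.ideal.comap g.map).map g.dom.ideal.subtype := by
    refine Submodule.mul_le.2 fun m hm n hn => ?_
    refine ⟨⟨m * n, (g.dom.isIdeal n m hm).2⟩, ?_, rfl⟩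
    have := g.map_mul ⟨m, hm⟩ n
    change g.map _ ∈ f.dom.ideal
    rw [this]
    exact (f.dom.isIdeal _ n hn).1
  obtain ⟨y, hy, rfl⟩ := this hx
  exact hy

/-- The composition `x ↦ f (g x)` of partial maps `f : I → A` and `g : J → A`, defined on the
product ideal `J I`. -/
def mul (f g : PartialHom R H A) : PartialHom R H A where
  dom := g.dom.mul f.dom
  map := f.map ∘ₗ (g.map ∘ₗ Submodule.inclusion (mul_le_dom f g)).codRestrict f.dom.ideal
    (fun x => map_mem_dom f g x x.2)
  map_mul x a := by
    have e1 := g.map_mul ⟨x, mul_le_dom f g x.2⟩ a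
    have e2 := f.map_mul ⟨_, map_mem_dom f g x x.2⟩ a
    exact (f.map_congr _ e1).trans e2

theorem smul_mul_eq (h : H) (u a : A) :
    (h • u) * a = sweedler ((Algebra.lsmul R R A).toLinearMap.compl₂
      (LinearMap.mulLeft R u ∘ₗ orbitMap R H a ∘ₗ HopfAlgebra.antipode R)) h := by
  let T : H →ₗ[R] H →ₗ[R] H →ₗ[R] A := LinearMap.mk₂ R
    (fun g k => LinearMap.mulLeft R (g • u) ∘ₗ Algebra.lsmul R R A k ∘ₗ orbitMap R H a ∘ₗ
      HopfAlgebra.antipode R)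
    (by intros; ext; simp [add_smul, add_mul]) (by intros; ext; simp)
    (by intros; ext; simp [mul_add]) (by intros; ext; simp)
  let C : H →ₗ[R] H →ₗ[R] A := LinearMap.mk₂ R
    (fun g k => (Coalgebra.counit k : R) • ((g • u) * a))
    (by intros; simp [add_smul, add_mul])
    (by intros; simp only [smul_assoc, smul_mul_assoc]; exact smul_comm _ _ _)
    (by intros; simp [add_smul]) (by intros; simp [mul_smul])
  rw [sweedler_assoc T _ C]
  · let r := Coalgebra.Repr.arbitrary R h
    rw [sweedler_repr _ r]
    have := congrArg (fun y => (y • u) * a)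
      (congrArg (TensorProduct.rid R H) (Coalgebra.sum_tmul_counit_eq r))
    simp only [map_sum, TensorProduct.rid_tmul, one_smul, Finset.sum_smul, Finset.sum_mul] at this
    simp only [C, LinearMap.mk₂_apply]
    rw [← this]
    simp
  · intro g k
    rw [sweedler_repr _ (Coalgebra.Repr.arbitrary R g)]
    have := StableDenseIdeal.smul_mul_repr g u (HopfAlgebra.antipode R k • a)
      (Coalgebra.Repr.arbitrary R g)
    simpa [T] using this
  · intro g k
    rw [sweedler_repr _ (Coalgebra.Repr.arbitrary R k)]
    have := congrArg (fun y => (g • u) * (y • a))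
      (HopfAlgebra.sum_mul_antipode_eq_smul (Coalgebra.Repr.arbitrary R k))
    simp only [Finset.sum_smul, Finset.mul_sum, smul_assoc, one_smul, mul_smul_comm,
      mul_smul] at this
    simpa [T, C] using this.symm

theorem antipode_smul_mul (h : H) (x a : A) :
    HopfAlgebra.antipode R h • (x * a) = sweedler ((LinearMap.mul R A).flip.compl₁₂
      (orbitMap R H a ∘ₗ HopfAlgebra.antipode R)
      (orbitMap R H x ∘ₗ HopfAlgebra.antipode R)) h := by
  rw [HopfModuleAlgebra.smul_mul (R := R), sweedler, LinearMap.comp_apply, comul_antipode]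
  rw [sweedler_repr _ (Coalgebra.Repr.arbitrary R h), sweedler_repr _ (Coalgebra.Repr.arbitrary R h)]
  simp

/-- The linear map `k ↦ f (S k • x)`. -/
def antipodeOrbit (f : PartialHom R H A) (x : f.dom.ideal) : H →ₗ[R] A :=
  f.map ∘ₗ (orbitMap R H (x : A)).codRestrict f.dom.ideal
    (fun k => f.dom.isStable k x x.2) ∘ₗ HopfAlgebra.antipode R

theorem antipodeOrbit_apply (f : PartialHom R H A) (x : f.dom.ideal) (k : H) :
    f.antipodeOrbit x k =
      f.map ⟨HopfAlgebra.antipode R k • (x : A), f.dom.isStable _ x x.2⟩ := rfl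

theorem antipodeOrbit_mul (f : PartialHom R H A) (x : f.dom.ideal) (a : A) (k : H) :
    f.antipodeOrbit ⟨x * a, (f.dom.isIdeal a x x.2).2⟩ k =
      sweedler ((LinearMap.mul R A).flip.compl₁₂
        (orbitMap R H a ∘ₗ HopfAlgebra.antipode R) (f.antipodeOrbit x)) k := by
  let r := Coalgebra.Repr.arbitrary R k
  have e := antipode_smul_mul (R := R) k (x : A) a
  rw [sweedler_repr _ r] at e ⊢
  have hmem : ∀ i, (HopfAlgebra.antipode R (r.right i) • (x : A)) *
      (HopfAlgebra.antipode R (r.left i) • a) ∈ f.dom.ideal := fun i =>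
    (f.dom.isIdeal _ _ (f.dom.isStable _ x x.2)).2
  have e2 : (⟨HopfAlgebra.antipode R k • ((x : A) * a), f.dom.isStable _ _
      (f.dom.isIdeal a x x.2).2⟩ : f.dom.ideal) = ∑ i ∈ r.index, ⟨_, hmem i⟩ := by
    apply Subtype.ext
    simpa using e
  rw [antipodeOrbit_apply]
  simp only [e2, map_sum]
  refine Finset.sum_congr rfl fun i _ => ?_
  exact f.map_mul ⟨_, f.dom.isStable (HopfAlgebra.antipode R (r.right i)) x x.2⟩ _

/-- The action of `h : H` on a partial map `f : I → A`: the map `x ↦ ∑ h₁ • f (S h₂ • x)`. -/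
def hsmul (h : H) (f : PartialHom R H A) : PartialHom R H A where
  dom := f.dom
  map :=
    { toFun := fun x => sweedler
        ((Algebra.lsmul R R A).toLinearMap.compl₂ (f.antipodeOrbit x)) h
      map_add' := fun x y => by
        have e : f.antipodeOrbit (x + y) = f.antipodeOrbit x + f.antipodeOrbit y := by
          ext k
          simp only [antipodeOrbit_apply, LinearMap.add_apply, ← map_add]
          congr 1
          exact Subtype.ext (smul_add _ _ _)
        simp [e, sweedler_repr _ (Coalgebra.Repr.arbitrary R h), Finset.sum_add_distrib]
      map_smul' := fun r x => by
        have e : f.antipodeOrbit (r • x) = r • f.antipodeOrbit x := by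
          ext k
          simp only [antipodeOrbit_apply, LinearMap.smul_apply, ← map_smul]
          congr 1
          exact Subtype.ext (smul_comm _ _ _)
        simp only [e, sweedler_repr _ (Coalgebra.Repr.arbitrary R h), Finset.smul_sum]
        exact Finset.sum_congr rfl fun i _ => smul_comm _ _ _ }
  map_mul x a := by
    let φ := f.antipodeOrbit x
    let T : H →ₗ[R] H →ₗ[R] H →ₗ[R] A := LinearMap.mk₂ R
      (fun g k => Algebra.lsmul R R A g ∘ₗ
        LinearMap.mulRight R (HopfAlgebra.antipode R k • a) ∘ₗ φ)
      (by intros; ext; simp) (by intros; ext; simp)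
      (by intros; ext; simp [add_smul, mul_add]) (by intros; ext; simp; exact smul_comm _ _ _)
    let B : H →ₗ[R] H →ₗ[R] A :=
      ((Algebra.lsmul R R A).toLinearMap.compl₂ φ).compr₂ (LinearMap.mulRight R a)
    have key := sweedler_assoc T B ((Algebra.lsmul R R A).toLinearMap.compl₂
      (f.antipodeOrbit ⟨x * a, (f.dom.isIdeal a x x.2).2⟩)) ?_ ?_ h
    · refine key.symm.trans ?_
      change _ = sweedler ((Algebra.lsmul R R A).toLinearMap.compl₂ φ) h * a
      simp [B, sweedler_repr _ (Coalgebra.Repr.arbitrary R h), Finset.sum_mul]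
    · intro g k
      have := smul_mul_eq (R := R) g (φ k) a
      rw [sweedler_repr _ (Coalgebra.Repr.arbitrary R g)] at this ⊢
      simpa [B, T] using this
    · intro g k
      have := congrArg (g • ·) (antipodeOrbit_mul f x a k)
      simp only [sweedler_repr _ (Coalgebra.Repr.arbitrary R k)] at this ⊢
      simpa [T, φ, Finset.smul_sum] using this

theorem hsmul_map_repr (h : H) (f : PartialHom R H A) (x : f.dom.ideal) {κ : Type*}
    (r : Coalgebra.Repr R h κ) :
    (hsmul h f).map x = ∑ i ∈ r.index, r.left i •
      f.map ⟨HopfAlgebra.antipode R (r.right i) • (x : A), f.dom.isStable _ x x.2⟩ :=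
  sweedler_repr _ r

/-- A partial map that commutes with the action of `H` is invariant under the action of `H` on
partial maps, and conversely. -/
theorem map_hsmul_iff (f : PartialHom R H A) :
    (∀ (h : H) (x : f.dom.ideal), (hsmul h f).map x = (Coalgebra.counit h : R) • f.map x) ↔
      ∀ (h : H) (x : f.dom.ideal), f.map ⟨h • (x : A), f.dom.isStable h x x.2⟩ = h • f.map x := by
  constructor
  · intro hf h x
    let ev : H →ₗ[R] A := f.map ∘ₗ (orbitMap R H (x : A)).codRestrict f.dom.ideal
      (fun k => f.dom.isStable k x x.2)
    have hev : ∀ k, ev k = f.map ⟨k • (x : A), f.dom.isStable k x x.2⟩ := fun _ => rfl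
    let T : H →ₗ[R] H →ₗ[R] H →ₗ[R] A := LinearMap.mk₂ R
      (fun g k => Algebra.lsmul R R A g ∘ₗ ev ∘ₗ LinearMap.mulLeft R (HopfAlgebra.antipode R k))
      (by intros; ext; simp) (by intros; ext; simp)
      (by intros; ext; simp [add_mul]) (by intros; ext; simp; exact smul_comm _ _ _)
    let B : H →ₗ[R] H →ₗ[R] A := (LinearMap.lsmul R A).compl₁₂ Coalgebra.counit ev
    let C : H →ₗ[R] H →ₗ[R] A := LinearMap.mk₂ R
      (fun g k => (Coalgebra.counit k : R) • g • f.map x)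
      (by intros; simp [add_smul]) (by intros; simp only [smul_assoc]; exact smul_comm _ _ _)
      (by intros; simp [add_smul]) (by intros; simp [mul_smul])
    have key := sweedler_assoc T B C ?_ ?_ h
    · let r := Coalgebra.Repr.arbitrary R h
      rw [sweedler_repr _ r, sweedler_repr _ r] at key
      have e1 := congrArg ev
        (congrArg (TensorProduct.lid R H) (Coalgebra.sum_counit_tmul_eq r))
      have e2 := congrArg (· • f.map x)
        (congrArg (TensorProduct.rid R H) (Coalgebra.sum_tmul_counit_eq r))
      simp only [map_sum, TensorProduct.rid_tmul, TensorProduct.lid_tmul, one_smul,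
        Finset.sum_smul, map_smul, smul_assoc] at e1 e2
      rw [← hev, ← e1, ← e2]
      exact key
    · intro g k
      have := hf g ⟨k • (x : A), f.dom.isStable k x x.2⟩
      rw [hsmul_map_repr g f _ (Coalgebra.Repr.arbitrary R g)] at this
      rw [sweedler_repr _ (Coalgebra.Repr.arbitrary R g)]
      simp only [smul_smul, ← hev] at this
      exact this.symm
    · intro g k
      rw [sweedler_repr _ (Coalgebra.Repr.arbitrary R k)]
      have := congrArg (fun y => g • ev y)
        (HopfAlgebra.sum_antipode_mul_eq_smul (Coalgebra.Repr.arbitrary R k))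
      simp only [map_sum, Finset.smul_sum, map_smul] at this
      refine Eq.trans ?_ this.symm
      simp only [C, LinearMap.mk₂_apply, hev, one_smul]
      exact smul_comm _ _ _
  · intro hf h x
    rw [hsmul_map_repr h f x (Coalgebra.Repr.arbitrary R h)]
    simp only [hf, smul_smul, ← Finset.sum_smul,
      HopfAlgebra.sum_mul_antipode_eq_smul, smul_assoc, one_smul]

end

end PartialHom

variable (R H A) in
/-- Cohen's right Martindale ring of quotients `Q₀(A)`: equivalence classes of right `A`-linear maps
`I → A`, where `I` runs through the `H`-stable ideals with zero left and right annihilator. -/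
def MartindaleQuotient : Type u := Quotient (PartialHom.setoid R H A)

namespace MartindaleQuotient

/-- The class `[f : I → A]`. -/
def mk (f : PartialHom R H A) : MartindaleQuotient R H A := Quotient.mk _ f

theorem mk_eq_of {f g : PartialHom R H A}
    (h : ∀ x (hf : x ∈ f.dom.ideal) (hg : x ∈ g.dom.ideal), f.map ⟨x, hf⟩ = g.map ⟨x, hg⟩) :
    mk f = mk g := Quotient.sound (PartialHom.rel_of_eq h)

theorem mk_eq_iff {f g : PartialHom R H A} : mk f = mk g ↔ PartialHom.Rel f g :=
  ⟨fun h => Quotient.exact h, fun h => Quotient.sound h⟩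

instance : Zero (MartindaleQuotient R H A) := ⟨mk (PartialHom.zero R H A)⟩

instance : One (MartindaleQuotient R H A) := ⟨mk (PartialHom.one R H A)⟩

/-- `[f] + [g] = [f + g : I ∩ J → A]`. -/
instance : Add (MartindaleQuotient R H A) :=
  ⟨Quotient.map₂ PartialHom.add fun _ _ h1 _ _ h2 => PartialHom.rel_of_eq fun x hx hy =>
    congrArg₂ (· + ·) (h1.eq x hx.1 hy.1) (h2.eq x hx.2 hy.2)⟩

instance : Neg (MartindaleQuotient R H A) :=
  ⟨Quotient.map PartialHom.neg fun _ _ h => PartialHom.rel_of_eq fun x hx hy =>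
    congrArg (- ·) (h.eq x hx hy)⟩

/-- `r • [f] = [r • f]` for `r : R`. -/
instance : SMul R (MartindaleQuotient R H A) :=
  ⟨fun r => Quotient.map (PartialHom.rsmul r) fun _ _ h => PartialHom.rel_of_eq fun x hx hy =>
    congrArg (r • ·) (h.eq x hx hy)⟩

variable [HopfModuleAlgebra R H A]

/-- `[f] * [g] = [f ∘ g : J I → A]` for `f : I → A` and `g : J → A`. -/
instance : Mul (MartindaleQuotient R H A) :=
  ⟨Quotient.map₂ PartialHom.mul fun f f' h1 g g' h2 => PartialHom.rel_of_eq fun x hx hy => by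
    have e := h2.eq x (PartialHom.mul_le_dom f g hx) (PartialHom.mul_le_dom f' g' hy)
    have m := PartialHom.map_mem_dom f g x hx
    have m' := PartialHom.map_mem_dom f' g' x hy
    exact (f.map_congr m e).trans (h1.eq _ (e ▸ m) m')⟩

/-- `h • [f] = [h · f]`, where `(h · f) x = ∑ h₁ • f (S h₂ • x)`. -/
instance : SMul H (MartindaleQuotient R H A) :=
  ⟨fun h => Quotient.map (PartialHom.hsmul h) fun f g hfg => PartialHom.rel_of_eq fun x hx hy => by
    have e1 := PartialHom.hsmul_map_repr h f ⟨x, hx⟩ (Coalgebra.Repr.arbitrary R h)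
    have e2 := PartialHom.hsmul_map_repr h g ⟨x, hy⟩ (Coalgebra.Repr.arbitrary R h)
    refine e1.trans (Eq.trans ?_ e2.symm)
    exact Finset.sum_congr rfl fun i _ => congrArg _ (hfg.eq _ _ _)⟩

theorem smul_mk (h : H) (f : PartialHom R H A) : h • mk f = mk (PartialHom.hsmul h f) := rfl

instance : Ring (MartindaleQuotient R H A) :=
  Ring.ofMinimalAxioms
    (by
      rintro ⟨f⟩ ⟨g⟩ ⟨k⟩
      exact mk_eq_of fun x _ _ => add_assoc _ _ _)
    (by
      rintro ⟨f⟩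
      exact mk_eq_of fun x _ _ => zero_add _)
    (by
      rintro ⟨f⟩
      exact mk_eq_of fun x _ _ => neg_add_cancel _)
    (by
      rintro ⟨f⟩ ⟨g⟩ ⟨k⟩
      exact mk_eq_of fun x _ _ => rfl)
    (by
      rintro ⟨f⟩
      exact mk_eq_of fun x _ _ => rfl)
    (by
      rintro ⟨f⟩
      exact mk_eq_of fun x _ _ => rfl)
    (by
      rintro ⟨f⟩ ⟨g⟩ ⟨k⟩
      exact mk_eq_of fun x hx hy => map_add f.map
        ⟨_, PartialHom.map_mem_dom f g x hy.1⟩ ⟨_, PartialHom.map_mem_dom f k x hy.2⟩)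
    (by
      rintro ⟨f⟩ ⟨g⟩ ⟨k⟩
      exact mk_eq_of fun x _ _ => rfl)

theorem mk_invariant_iff (f : PartialHom R H A) :
    (∀ h : H, h • mk f = (Coalgebra.counit h : R) • mk f) ↔
      ∀ (h : H) (x : f.dom.ideal), f.map ⟨h • (x : A), f.dom.isStable h x x.2⟩ = h • f.map x := by
  rw [← PartialHom.map_hsmul_iff]
  refine forall_congr' fun h => ⟨fun e x => ?_, fun e => mk_eq_of fun x hx _ => e ⟨x, hx⟩⟩
  exact (mk_eq_iff.1 e).eq x x.2 x.2

variable (R H A) in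
/-- The subring `Q₀^H` of `H`-invariant elements: `h • q = ε(h) • q` for all `h`. -/
def invariants : Subring (MartindaleQuotient R H A) where
  carrier := {q | ∀ h : H, h • q = (Coalgebra.counit h : R) • q}
  zero_mem' := (mk_invariant_iff _).2 fun h _ => (smul_zero h).symm
  one_mem' := (mk_invariant_iff _).2 fun _ _ => rfl
  add_mem' := by
    rintro ⟨f⟩ ⟨g⟩ hf hg
    have hf' := (mk_invariant_iff f).1 hf
    have hg' := (mk_invariant_iff g).1 hg
    refine (mk_invariant_iff (f.add g)).2 fun h x => ?_
    exact (congrArg₂ (· + ·) (hf' h ⟨x, x.2.1⟩) (hg' h ⟨x, x.2.2⟩)).trans (smul_add _ _ _).symm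
  neg_mem' := by
    rintro ⟨f⟩ hf
    have hf' := (mk_invariant_iff f).1 hf
    refine (mk_invariant_iff f.neg).2 fun h x => ?_
    exact (congrArg (- ·) (hf' h x)).trans (smul_neg _ _).symm
  mul_mem' := by
    rintro ⟨f⟩ ⟨g⟩ hf hg
    have hf' := (mk_invariant_iff f).1 hf
    have hg' := (mk_invariant_iff g).1 hg
    refine (mk_invariant_iff (f.mul g)).2 fun h x => ?_
    have hx := PartialHom.mul_le_dom f g x.2
    have m := PartialHom.map_mem_dom f g x x.2
    exact (f.map_congr (PartialHom.map_mem_dom f g (h • (x : A))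
      ((g.dom.mul f.dom).isStable h x x.2)) (hg' h ⟨x, hx⟩)).trans (hf' h ⟨_, m⟩)

variable (R H A) in
/-- The subring `Z(Q₀)^H = Z(Q₀) ∩ Q₀^H` of central `H`-invariant elements. -/
def centralInvariants : Subring (MartindaleQuotient R H A) :=
  Subring.center (MartindaleQuotient R H A) ⊓ invariants R H A

end MartindaleQuotient

end ModuleAlgebra

/-! ### Self-injective hulls -/

section Hull

variable {S : Type*} [Ring S] {M E : Type u} [AddCommGroup M] [Module S M]
  [AddCommGroup E] [Module S E]

/-- `ι : M → E` is an injective hull: `E` is injective and `ι` is an essential monomorphism. -/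
structure IsInjectiveHull (ι : M →ₗ[S] E) : Prop where
  injective_module : Module.Injective S E
  injective : Function.Injective ι
  essential : ∀ N : Submodule S E, N ⊓ LinearMap.range ι = ⊥ → N = ⊥

variable (M) in
/-- `N` is `M`-generated: it is an epimorphic image of a direct sum of copies of `M`. -/
def IsGeneratedBy (N : Submodule S E) : Prop :=
  ∃ (κ : Type u) (p : (κ →₀ M) →ₗ[S] N), Function.Surjective p

variable (S M E) in
/-- The largest `M`-generated submodule of `E`, namely the sum of the images of all linear maps
`M → E`. When `E` is the injective hull of `M`, this is the self-injective hull of `M`. -/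
def selfInjectiveHull : Submodule S E :=
  ⨆ f : M →ₗ[S] E, LinearMap.range f

theorem selfInjectiveHull_isGreatest :
    IsGreatest {N : Submodule S E | IsGeneratedBy M N} (selfInjectiveHull S M E) := by
  constructor
  · let p : ((M →ₗ[S] E) →₀ M) →ₗ[S] E := Finsupp.lsum ℕ (fun f => f)
    have hp : LinearMap.range p = selfInjectiveHull S M E := by
      apply le_antisymm
      · rintro _ ⟨x, rfl⟩
        induction x using Finsupp.induction_linear with
        | zero => simp
        | add a b ha hb => simpa using add_mem ha hb
        | single f m => exact Submodule.mem_iSup_of_mem f ⟨m, by simp [p]⟩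
      · refine iSup_le fun f => ?_
        rintro _ ⟨m, rfl⟩
        exact ⟨Finsupp.single f m, by simp [p]⟩
    exact ⟨M →ₗ[S] E, p.codRestrict _ fun x => hp ▸ ⟨x, rfl⟩, fun ⟨y, hy⟩ => by
      obtain ⟨x, rfl⟩ := hp ▸ hy
      exact ⟨x, rfl⟩⟩
  · rintro N ⟨κ, p, hp⟩ y hy
    obtain ⟨x, hx⟩ := hp ⟨y, hy⟩
    have e : y = N.subtype (p x) := by rw [hx]; rfl
    rw [e]
    clear e hx hy
    induction x using Finsupp.induction_linear with
    | zero => simp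
    | add a b ha hb => simpa using add_mem ha hb
    | single i m =>
      exact Submodule.mem_iSup_of_mem (N.subtype ∘ₗ p ∘ₗ Finsupp.lsingle i) ⟨m, rfl⟩

/-- The inclusion of `M` into its self-injective hull. -/
def toSelfInjectiveHull (ι : M →ₗ[S] E) : M →ₗ[S] selfInjectiveHull S M E :=
  ι.codRestrict _ fun m => Submodule.mem_iSup_of_mem ι ⟨m, rfl⟩

end Hull

/-- A ring is von Neumann regular if every element `a` is of the form `a * b * a`. -/
def IsVonNeumannRegular (S : Type*) [Ring S] : Prop :=
  ∀ a : S, ∃ b : S, a * b * a = a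

end HopfAction

end

noncomputable section

open scoped TensorProduct

namespace HopfAction

/-! ### The multiplication ring and its submodules of `A`, which are the `H`-stable ideals. -/

section Annihilator

variable {R : Type w} [CommRing R] {H : Type v} [Ring H] [HopfAlgebra R H]
  {A : Type u} [Ring A] [Algebra R A] [Module H A] [IsScalarTower R H A]

/-! Write M for the multiplication ring. Its submodules in `A` are the `H`-stable ideals, so partial
M-linear maps `A → A` can be handled through their graphs: submodules `G` of `A × A` that are
functional, meaning that `(0, z) ∈ G` forces `z = 0`. Left annihilators of stable ideals are stable,
and `H`-semiprimeness gives `N ⊓ ann N = ⊥`. The three alternative hypotheses serve only to show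
that right annihilators lie in left ones (`annihilatorSymmetric`), so that `ann N = ⊥` already puts
`N` in the filter.

A class in Q₀ is central and invariant exactly when a representing map is M-linear
(`mk_mem_centralInvariants`). Hence a functional relation with dense domain defines a central
invariant (`exists_partialHom`). Any functional relation becomes densely defined after being
extended by zero on the annihilator of its domain (`exists_centralInvariant`). Regularity follows by
applying this to a partial inverse of c, and self-injectivity by applying it, through Baer's
criterion, to the relation that a homomorphism from an ideal induces on `A`.

For an endomorphism f of the self-injective hull, the relation `f x = a` on `A` is functional
because `A` embeds in the hull, and has dense domain because the embedding in `E` is essential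
(`ann_domain_endGraph`). This gives ψ. It is injective because an endomorphism vanishing on a dense
ideal is zero (`end_eq_zero`), and surjective because M-linear partial maps extend by injectivity of
`E` (`exists_extension`). -/

theorem mulLeft_mem (a : A) : LinearMap.mulLeft R a ∈ multiplicationRing R H A :=
  Subring.subset_closure (.inl (.inl ⟨a, rfl⟩))

theorem mulRight_mem (a : A) : LinearMap.mulRight R a ∈ multiplicationRing R H A :=
  Subring.subset_closure (.inl (.inr ⟨a, rfl⟩))

theorem lsmul_mem (h : H) : Algebra.lsmul R R A h ∈ multiplicationRing R H A :=
  Subring.subset_closure (.inr ⟨h, rfl⟩)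

variable (R H A) in
/-- The tautological action of the multiplication ring on `A`, named to speed up instance search. -/
abbrev multiplicationModule : Module (multiplicationRing R H A) A :=
  Subsemiring.instModuleSubtypeMem _

attribute [local instance] multiplicationModule

variable (R H) in
/-- Left multiplication by `a` as an element of the multiplication ring. -/
def leftMul (a : A) : multiplicationRing R H A := ⟨LinearMap.mulLeft R a, mulLeft_mem a⟩

variable (R H) in
/-- Right multiplication by `a` as an element of the multiplication ring. -/
def rightMul (a : A) : multiplicationRing R H A := ⟨LinearMap.mulRight R a, mulRight_mem a⟩

variable (R A) in
/-- The action of `h` as an element of the multiplication ring. -/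
def hopfAct (h : H) : multiplicationRing R H A := ⟨Algebra.lsmul R R A h, lsmul_mem h⟩

@[simp] theorem leftMul_smul (a x : A) : leftMul R H a • x = a * x := rfl
@[simp] theorem rightMul_smul (a x : A) : rightMul R H a • x = x * a := rfl
@[simp] theorem hopfAct_smul (h : H) (x : A) : hopfAct R A h • x = h • x := rfl

/-- Induction principle for elements of the multiplication ring. -/
theorem multiplicationRing_induction {p : multiplicationRing R H A → Prop}
    (left : ∀ a, p (leftMul R H a)) (right : ∀ a, p (rightMul R H a))
    (act : ∀ h, p (hopfAct R A h)) (one : p 1) (zero : p 0)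
    (add : ∀ m n, p m → p n → p (m + n)) (neg : ∀ m, p m → p (-m))
    (mul : ∀ m n, p m → p n → p (m * n)) (m : multiplicationRing R H A) : p m := by
  obtain ⟨m, hm⟩ := m
  induction hm using Subring.closure_induction with
  | mem x hx =>
    obtain (⟨a, rfl⟩ | ⟨a, rfl⟩) | ⟨h, rfl⟩ := hx
    exacts [left a, right a, act h]
  | zero => exact zero
  | one => exact one
  | add x y hx hy ihx ihy => exact add _ _ ihx ihy
  | neg x hx ih => exact neg _ ih
  | mul x y hx hy ihx ihy => exact mul _ _ ihx ihy

/-- An additive relation that is closed under the generators of the multiplication ring is a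
submodule. -/
theorem smul_mem_of_generators {X : Type*} [AddCommGroup X] [Module (multiplicationRing R H A) X]
    (N : AddSubgroup X) (left : ∀ a : A, ∀ x ∈ N, leftMul R H a • x ∈ N)
    (right : ∀ a : A, ∀ x ∈ N, rightMul R H a • x ∈ N)
    (act : ∀ h : H, ∀ x ∈ N, hopfAct R A h • x ∈ N) (m : multiplicationRing R H A) :
    ∀ x ∈ N, m • x ∈ N := by
  induction m using multiplicationRing_induction with
  | left a => exact left a
  | right a => exact right a
  | act h => exact act h
  | one => intro x hx; rwa [one_smul]
  | zero => intro x _; rw [zero_smul]; exact N.zero_mem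
  | add m n hm hn => intro x hx; rw [add_smul]; exact N.add_mem (hm x hx) (hn x hx)
  | neg m hm => intro x hx; rw [neg_smul]; exact N.neg_mem (hm x hx)
  | mul m n hm hn => intro x hx; rw [mul_smul]; exact hm _ (hn x hx)

/-- Ring-module submodules of `A` as `R`-submodules. -/
def toIdeal (N : Submodule (multiplicationRing R H A) A) : Submodule R A where
  carrier := N
  add_mem' := N.add_mem
  zero_mem' := N.zero_mem
  -- Scalars from `R` act through left multiplication by `r • 1`.
  smul_mem' r x hx := by
    have := N.smul_mem (leftMul R H (r • (1 : A))) hx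
    rwa [leftMul_smul, smul_mul_assoc, one_mul] at this

theorem toIdeal_isIdeal (N : Submodule (multiplicationRing R H A) A) : IsIdeal (toIdeal N) := by
  intro a x hx
  exact ⟨N.smul_mem (leftMul R H a) hx, N.smul_mem (rightMul R H a) hx⟩

theorem toIdeal_isStable (N : Submodule (multiplicationRing R H A) A) : IsStable H (toIdeal N) :=
  fun h _ hx => N.smul_mem (hopfAct R A h) hx

/-- A stable ideal as a submodule over the multiplication ring. -/
def ofIdeal (I : Submodule R A) (hI : IsIdeal I) (hS : IsStable H I) :
    Submodule (multiplicationRing R H A) A where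
  carrier := I
  add_mem' := I.add_mem
  zero_mem' := I.zero_mem
  smul_mem' m x hx := smul_mem_of_generators (R := R) (H := H) I.toAddSubgroup (fun a x hx => (hI a x hx).1)
    (fun a x hx => (hI a x hx).2) hS m x hx

/-- The first projection of a relation on `A`. -/
abbrev domain (G : Submodule (multiplicationRing R H A) (A × A)) :
    Submodule (multiplicationRing R H A) A :=
  G.map (LinearMap.fst (multiplicationRing R H A) A A)

theorem mem_domain {G : Submodule (multiplicationRing R H A) (A × A)} {x : A} :
    x ∈ domain G ↔ ∃ y, (x, y) ∈ G := by
  constructor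
  · rintro ⟨⟨x, y⟩, h, rfl⟩
    exact ⟨y, h⟩
  · rintro ⟨y, h⟩
    exact ⟨_, h, rfl⟩

theorem isNilpotent_of_mul_eq_zero {I : Submodule R A} (h : ∀ x ∈ I, ∀ y ∈ I, x * y = 0) :
    IsNilpotent I :=
  ⟨2, by
    rw [pow_two]
    exact (Submodule.eq_bot_iff _).2 fun z hz => by
      simpa using (Submodule.mul_le (P := (⊥ : Submodule R A))).2
        (fun x hx y hy => by simpa using h x hx y hy) hz⟩

/-- An `H`-stable ideal of square zero in an `H`-semiprime algebra is zero. -/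
theorem IsHSemiprime.eq_bot (hA : IsHSemiprime R H A)
    {N : Submodule (multiplicationRing R H A) A} (h : ∀ x ∈ N, ∀ y ∈ N, x * y = 0) : N = ⊥ := by
  have := hA (toIdeal N) (toIdeal_isIdeal N) (toIdeal_isStable N) (isNilpotent_of_mul_eq_zero h)
  refine (Submodule.eq_bot_iff _).2 fun x hx => ?_
  have hx' : x ∈ toIdeal N := hx
  rwa [this, Submodule.mem_bot] at hx'

/-! ### Annihilators of stable ideals. -/

variable [HopfModuleAlgebra R H A]

/-- Takes `h` off the first factor, so that `u` again multiplies an element of the orbit of `a`.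
This is what makes left annihilators of stable ideals stable, with no condition on the antipode. -/
theorem hopf_smul_mul_repr (h : H) (u a : A) {κ : Type*} (r : Coalgebra.Repr R h κ) :
    (h • u) * a =
      ∑ i ∈ r.index, r.left i • (u * (HopfAlgebra.antipode R (r.right i) • a)) := by
  rw [PartialHom.smul_mul_eq (R := R), sweedler_repr _ r]
  simp

/-- `x (S k • a) = ∑ S k₁ • ((k₂ • x) a)`. -/
theorem mul_antipode_smul (k : H) (x a : A) {κ : Type*} (r : Coalgebra.Repr R k κ) :
    x * (HopfAlgebra.antipode R k • a) =
      ∑ i ∈ r.index, HopfAlgebra.antipode R (r.left i) • ((r.right i • x) * a) := by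
  -- The threefold sum `∑ (S k₂ • k₃ • x) (S k₁ • a)`. Grouping `k₁, k₂` collects `S` of a product
  -- by anticomultiplicativity of `S`; grouping `k₂, k₃` cancels `S k₂` against `k₃`.
  let T : H →ₗ[R] H →ₗ[R] H →ₗ[R] A := LinearMap.mk₂ R
    (fun g k => LinearMap.mulRight R (HopfAlgebra.antipode R g • a) ∘ₗ
      Algebra.lsmul R R A (HopfAlgebra.antipode R k) ∘ₗ orbitMap R H x)
    (by intros; ext; simp [add_smul, mul_add]) (by intros; ext; simp)
    (by intros; ext; simp [add_mul]) (by intros; ext; simp)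
  let B : H →ₗ[R] H →ₗ[R] A := LinearMap.mk₂ R
    (fun g k => HopfAlgebra.antipode R g • ((k • x) * a))
    (by intros; simp [add_smul]) (by intros; simp)
    (by intros; simp [add_smul, add_mul])
    (by intros; simp only [smul_assoc, smul_mul_assoc]; exact smul_comm _ _ _)
  let C : H →ₗ[R] H →ₗ[R] A := LinearMap.mk₂ R
    (fun g k => (Coalgebra.counit k : R) • (x * (HopfAlgebra.antipode R g • a)))
    (by intros; simp [add_smul, mul_add]) (by intros; simp; exact smul_comm _ _ _)
    (by intros; simp [add_smul]) (by intros; simp [mul_smul])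
  have key := sweedler_assoc T B C ?_ ?_ k
  · rw [sweedler_repr _ r, sweedler_repr _ r] at key
    refine Eq.trans ?_ key.symm
    have := congrArg (fun y => x * (HopfAlgebra.antipode R y • a))
      (congrArg (TensorProduct.rid R H) (Coalgebra.sum_tmul_counit_eq r))
    simp only [map_sum, TensorProduct.rid_tmul, one_smul, Finset.sum_smul, Finset.mul_sum] at this
    rw [← this]
    simp [C]
  · intro g k
    have := PartialHom.antipode_smul_mul (R := R) g (k • x) a
    rw [sweedler_repr _ (Coalgebra.Repr.arbitrary R g)] at this ⊢
    simpa [T, B] using this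
  · intro g k
    rw [sweedler_repr _ (Coalgebra.Repr.arbitrary R k)]
    have := congrArg (fun y => (y • x) * (HopfAlgebra.antipode R g • a))
      (HopfAlgebra.sum_antipode_mul_eq_smul (Coalgebra.Repr.arbitrary R k))
    simp only [Finset.sum_smul, Finset.sum_mul, smul_assoc, one_smul, smul_mul_assoc,
      mul_smul] at this
    simpa [T, C] using this.symm

/-- The left annihilator of an `H`-stable ideal is an `H`-stable ideal. -/
def ann (N : Submodule (multiplicationRing R H A) A) : Submodule (multiplicationRing R H A) A :=
  ofIdeal
    { carrier := {a | ∀ x ∈ N, a * x = 0}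
      add_mem' := fun ha hb x hx => by rw [add_mul, ha x hx, hb x hx, add_zero]
      zero_mem' := fun x _ => zero_mul x
      smul_mem' := fun r a ha x hx => by rw [smul_mul_assoc, ha x hx, smul_zero] }
    (fun b a ha => ⟨fun x hx => by rw [mul_assoc, ha x hx, mul_zero], fun x hx => by
      rw [mul_assoc]; exact ha _ (N.smul_mem (leftMul R H b) hx)⟩)
    (fun h a ha x hx => by
      rw [hopf_smul_mul_repr h a x (Coalgebra.Repr.arbitrary R h)]
      refine Finset.sum_eq_zero fun i _ => ?_
      exact (congrArg _ (ha _ (N.smul_mem (hopfAct R A _) hx))).trans (smul_zero _))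

theorem IsHSemiprime.inf_ann (hA : IsHSemiprime R H A)
    (N : Submodule (multiplicationRing R H A) A) : N ⊓ ann N = ⊥ :=
  hA.eq_bot fun _ hx y hy => hx.2 y hy.1

theorem IsHSemiprime.eq_zero_of_mem_ann (hA : IsHSemiprime R H A)
    {N : Submodule (multiplicationRing R H A) A} {x : A} (hx : x ∈ N) (hx' : x ∈ ann N) : x = 0 := by
  have : x ∈ N ⊓ ann N := ⟨hx, hx'⟩
  rwa [hA.inf_ann N, Submodule.mem_bot] at this

variable (R H A) in
/-- The right annihilator of every `H`-stable ideal is contained in its left annihilator. -/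
def AnnihilatorSymmetric : Prop :=
  ∀ (N : Submodule (multiplicationRing R H A) A) (a : A), (∀ x ∈ N, x * a = 0) → a ∈ ann N

/-- Let `K` be the right annihilator of `N`. The ideal `K ⊓ N` has square zero and contains `a * x`
for `a ∈ K`, `x ∈ N`, so it suffices that it vanishes. For semiprime `A` no stability is needed. In
the antipode case surjectivity writes each `h` as `S k`, and `mul_antipode_smul` shows that `K` is
stable, so `H`-semiprimeness applies. -/
theorem annihilatorSymmetric (hA : IsHSemiprime R H A)
    (hyp : (∀ a b : A, a * b = b * a) ∨ IsSemiprimeAlgebra R A ∨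
      Function.Bijective (HopfAlgebra.antipode R : H →ₗ[R] H)) :
    AnnihilatorSymmetric R H A := by
  intro N a ha
  obtain hc | hs | hb := hyp
  · exact fun x hx => by rw [hc, ha x hx]
  · let K : Submodule R A :=
      { carrier := {a | ∀ x ∈ N, x * a = 0}
        add_mem' := fun ha hb x hx => by rw [mul_add, ha x hx, hb x hx, add_zero]
        zero_mem' := fun x _ => mul_zero x
        smul_mem' := fun r a ha x hx => by rw [mul_smul_comm, ha x hx, smul_zero] }
    have hK : IsIdeal K := fun b a ha => ⟨fun x hx => by
        rw [← mul_assoc]; exact ha _ (N.smul_mem (rightMul R H b) hx),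
      fun x hx => by rw [← mul_assoc, ha x hx, zero_mul]⟩
    let J : Submodule R A := K ⊓ toIdeal N
    have hJ : J = ⊥ := hs J (fun b x hx => ⟨⟨(hK b x hx.1).1, (toIdeal_isIdeal N b x hx.2).1⟩,
        ⟨(hK b x hx.1).2, (toIdeal_isIdeal N b x hx.2).2⟩⟩)
      (isNilpotent_of_mul_eq_zero fun x hx y hy => hy.1 x hx.2)
    intro x hx
    have : a * x ∈ J := ⟨(hK x a ha).2, (toIdeal_isIdeal N a x hx).1⟩
    rwa [hJ, Submodule.mem_bot] at this
  · let K : Submodule (multiplicationRing R H A) A := ofIdeal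
      { carrier := {a | ∀ x ∈ N, x * a = 0}
        add_mem' := fun ha hb x hx => by rw [mul_add, ha x hx, hb x hx, add_zero]
        zero_mem' := fun x _ => mul_zero x
        smul_mem' := fun r a ha x hx => by rw [mul_smul_comm, ha x hx, smul_zero] }
      (fun b a ha => ⟨fun x hx => by
          rw [← mul_assoc]; exact ha _ (N.smul_mem (rightMul R H b) hx),
        fun x hx => by rw [← mul_assoc, ha x hx, zero_mul]⟩)
      (fun h a ha x hx => by
        obtain ⟨k, rfl⟩ := hb.2 h
        rw [mul_antipode_smul k x a (Coalgebra.Repr.arbitrary R k)]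
        refine Finset.sum_eq_zero fun i _ => ?_
        exact (congrArg _ (ha _ (N.smul_mem (hopfAct R A _) hx))).trans (smul_zero _))
    have hJ : K ⊓ N = ⊥ := hA.eq_bot fun x hx y hy => hy.1 x hx.2
    intro x hx
    have : a * x ∈ K ⊓ N :=
      ⟨K.smul_mem (rightMul R H x) (show a ∈ K from ha), N.smul_mem (leftMul R H a) hx⟩
    rwa [hJ, Submodule.mem_bot] at this

/-- A submodule with zero annihilator as a member of the filter of dense stable ideals. -/
def AnnihilatorSymmetric.dense (hs : AnnihilatorSymmetric R H A)
    (N : Submodule (multiplicationRing R H A) A) (hN : ann N = ⊥) : StableDenseIdeal R H A where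
  ideal := toIdeal N
  isIdeal := toIdeal_isIdeal N
  isStable := toIdeal_isStable N
  left_annihilator a ha := by
    rw [← Submodule.mem_bot (multiplicationRing R H A), ← hN]
    exact ha
  right_annihilator a ha := by
    rw [← Submodule.mem_bot (multiplicationRing R H A), ← hN]
    exact hs N a ha

end Annihilator

/-! ### Central invariants of Q₀ as functional relations on `A`. -/

section Martindale

variable {R : Type w} [CommRing R] {H : Type v} [Ring H] [HopfAlgebra R H]
  {A : Type u} [Ring A] [Algebra R A] [Module H A] [IsScalarTower R H A]

attribute [local instance] multiplicationModule

/-- Left multiplication by `a` as a partial map. -/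
def PartialHom.leftMul (a : A) : PartialHom R H A where
  dom := StableDenseIdeal.top R H A
  map := LinearMap.mulLeft R a ∘ₗ Submodule.subtype _
  map_mul x b := (mul_assoc a x b).symm

namespace MartindaleQuotient

theorem mk_surjective : Function.Surjective (mk : PartialHom R H A → MartindaleQuotient R H A) :=
  Quotient.mk_surjective

variable [HopfModuleAlgebra R H A]

theorem mk_mul (f g : PartialHom R H A) : mk f * mk g = mk (f.mul g) := rfl

variable (R H A) in
/-- The canonical embedding of `A` into its ring of quotients. -/
def lam : A →+* MartindaleQuotient R H A where
  toFun a := mk (PartialHom.leftMul a)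
  map_one' := mk_eq_of fun x _ _ => one_mul x
  map_mul' a b := mk_eq_of fun x _ _ => mul_assoc a b x
  map_zero' := mk_eq_of fun x _ _ => zero_mul x
  map_add' a b := mk_eq_of fun x _ _ => add_mul a b x

theorem mem_dom_mul_leftMul (g : PartialHom R H A) (y : A) {x : A} (hx : x ∈ g.dom.ideal) :
    x ∈ (g.mul (PartialHom.leftMul y)).dom.ideal := by
  have : (1 : A) * x ∈ (StableDenseIdeal.top R H A).ideal * g.dom.ideal :=
    Submodule.mul_mem_mul trivial hx
  rwa [one_mul] at this

theorem mem_dom_leftMul_mul (g : PartialHom R H A) (y : A) {x : A} (hx : x ∈ g.dom.ideal) :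
    x ∈ ((PartialHom.leftMul y).mul g).dom.ideal := by
  have : x * (1 : A) ∈ g.dom.ideal * (StableDenseIdeal.top R H A).ideal :=
    Submodule.mul_mem_mul hx trivial
  rwa [mul_one] at this

theorem mk_mul_lam_eq_iff (g : PartialHom R H A) (y z : A) :
    mk g * lam R H A y = lam R H A z ↔
      ∀ x (hx : x ∈ g.dom.ideal), g.map ⟨y * x, (g.dom.isIdeal y x hx).1⟩ = z * x := by
  constructor
  · intro h x hx
    exact (mk_eq_iff.1 h).eq x (mem_dom_mul_leftMul g y hx) trivial
  · intro h
    refine mk_eq_iff.2 ⟨g.dom, fun x hx => mem_dom_mul_leftMul g y hx, fun _ _ => trivial, h⟩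

/-- Evaluation of a partial map becomes multiplication in Q₀, which allows later identities to be
computed in the ring rather than with domains. -/
theorem mk_mul_lam (g : PartialHom R H A) {x : A} (hx : x ∈ g.dom.ideal) :
    mk g * lam R H A x = lam R H A (g.map ⟨x, hx⟩) :=
  (mk_mul_lam_eq_iff g _ _).2 fun y _ => g.map_mul ⟨x, hx⟩ y

theorem lam_injective : Function.Injective (lam R H A) := by
  intro a b h
  have := (mk_eq_iff.1 h).eq 1 trivial trivial
  exact (mul_one a).symm.trans (Eq.trans this (mul_one b))

theorem eq_zero_of_mul_lam (q : MartindaleQuotient R H A) (I : StableDenseIdeal R H A)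
    (h : ∀ x ∈ I.ideal, q * lam R H A x = 0) : q = 0 := by
  obtain ⟨g, rfl⟩ := mk_surjective q
  refine mk_eq_iff.2 ⟨I.inf g.dom, inf_le_right, fun _ _ => trivial, fun x hx => ?_⟩
  refine lam_injective (R := R) (H := H) ?_
  rw [← mk_mul_lam g hx.2, h x hx.1]
  exact (map_zero _).symm

/-- Commuting with left multiplications gives left linearity. Conversely, a bilinear `g` commutes
with every right linear `f` on products `m * n` with `m` in the domain of `f` and `n` in that of
`g`: both composites give `f m * g n`. -/
theorem mk_mem_centralInvariants (g : PartialHom R H A) :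
    mk g ∈ centralInvariants R H A ↔
      (∀ (a : A) (x : g.dom.ideal), g.map ⟨a * x, (g.dom.isIdeal a x x.2).1⟩ = a * g.map x) ∧
      ∀ (h : H) (x : g.dom.ideal), g.map ⟨h • (x : A), g.dom.isStable h x x.2⟩ = h • g.map x := by
  refine and_congr ?_ (mk_invariant_iff g)
  constructor
  · intro hg a x
    have := Subring.mem_center_iff.1 hg (lam R H A a)
    exact ((mk_eq_iff.1 this).eq x (mem_dom_leftMul_mul g a x.2)
      (mem_dom_mul_leftMul g a x.2)).symm
  · intro hg
    refine Subring.mem_center_iff.2 fun q => ?_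
    obtain ⟨f, rfl⟩ := mk_surjective q
    rw [mk_mul, mk_mul]
    refine mk_eq_of fun x hx hx' => ?_
    refine lam_injective (R := R) (H := H) ?_
    rw [← mk_mul_lam _ hx, ← mk_mul_lam _ hx', ← mk_mul, ← mk_mul, mul_assoc, mul_assoc]
    have hx'' : x ∈ f.dom.ideal * g.dom.ideal := hx'
    clear hx hx'
    induction hx'' using Submodule.mul_induction_on' with
    | mem_mul_mem m hm n hn =>
      have e1 := mk_mul_lam g (g.dom.isIdeal m n hn).1
      have e2 := mk_mul_lam f hm
      rw [e1, hg m ⟨n, hn⟩, map_mul, map_mul, ← mul_assoc, e2, ← mul_assoc (mk f), e2, ← map_mul,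
        ← map_mul, mk_mul_lam g (g.dom.isIdeal _ n hn).1, hg _ ⟨n, hn⟩]
    | add x _ y _ hx hy => rw [map_add, mul_add, mul_add, mul_add, mul_add, hx, hy]

/-- Central invariants commute with the multiplication ring. -/
theorem mul_lam_smul {c : MartindaleQuotient R H A} (hc : c ∈ centralInvariants R H A)
    (m : multiplicationRing R H A) : ∀ {y z : A}, c * lam R H A y = lam R H A z →
      c * lam R H A (m • y) = lam R H A (m • z) := by
  induction m using multiplicationRing_induction with
  | left a =>
    intro y z h
    rw [leftMul_smul, leftMul_smul, map_mul, map_mul, ← mul_assoc,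
      ← Subring.mem_center_iff.1 hc.1, mul_assoc, h]
  | right a =>
    intro y z h
    rw [rightMul_smul, rightMul_smul, map_mul, map_mul, ← mul_assoc, h]
  | act h =>
    intro y z hyz
    obtain ⟨g, rfl⟩ := mk_surjective c
    have hg := (mk_mem_centralInvariants g).1 hc
    rw [mk_mul_lam_eq_iff] at hyz ⊢
    -- The element `h • y` need not lie in the domain of `g`, so the identity is tested after right
    -- multiplication by `x` in the domain.
    intro x hx
    let r := Coalgebra.Repr.arbitrary R h
    have hS : ∀ i, HopfAlgebra.antipode R (r.right i) • x ∈ g.dom.ideal :=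
      fun i => g.dom.isStable _ x hx
    have hT : ∀ i, y * (HopfAlgebra.antipode R (r.right i) • x) ∈ g.dom.ideal :=
      fun i => (g.dom.isIdeal _ _ (hS i)).1
    have e : (⟨(hopfAct R A h • y) * x, (g.dom.isIdeal _ x hx).1⟩ : g.dom.ideal) =
        ∑ i ∈ r.index, ⟨r.left i • (y * (HopfAlgebra.antipode R (r.right i) • x)),
          g.dom.isStable _ _ (hT i)⟩ := by
      apply Subtype.ext
      rw [AddSubmonoidClass.coe_finsetSum]
      exact hopf_smul_mul_repr h y x r
    rw [e, map_sum, hopfAct_smul, hopf_smul_mul_repr h z x r]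
    refine Finset.sum_congr rfl fun i _ => ?_
    rw [← hyz _ (hS i)]
    exact hg.2 (r.left i) ⟨_, hT i⟩
  | one => intro y z h; rwa [one_smul, one_smul]
  | zero => intro y z _; rw [zero_smul, zero_smul, map_zero, mul_zero]
  | add m n hm hn =>
    intro y z h
    rw [add_smul, add_smul, map_add, map_add, mul_add, hm h, hn h]
  | neg m hm => intro y z h; rw [neg_smul, neg_smul, map_neg, map_neg, mul_neg, hm h]
  | mul m n hm hn => intro y z h; rw [mul_smul, mul_smul]; exact hm (hn h)

/-- The relation `c y = z` on `A` given by a central invariant `c`. -/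
def graph {c : MartindaleQuotient R H A} (hc : c ∈ centralInvariants R H A) :
    Submodule (multiplicationRing R H A) (A × A) where
  carrier := {p | c * lam R H A p.1 = lam R H A p.2}
  add_mem' := by
    intro p q hp hq
    change c * lam R H A (p.1 + q.1) = lam R H A (p.2 + q.2)
    rw [map_add, map_add, mul_add, hp, hq]
  zero_mem' := by
    change c * lam R H A 0 = lam R H A 0
    rw [map_zero, mul_zero]
  smul_mem' m p hp := mul_lam_smul hc m hp

/-- A functional relation with dense domain is the graph of a partial map that represents a central
invariant. -/
theorem exists_partialHom (hs : AnnihilatorSymmetric R H A)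
    (G : Submodule (multiplicationRing R H A) (A × A)) (h0 : ∀ z, (0, z) ∈ G → z = 0)
    (hd : ann (domain G) = ⊥) :
    ∃ q : PartialHom R H A, (∀ x, x ∈ q.dom.ideal ↔ ∃ y, (x, y) ∈ G) ∧
      (∀ x : q.dom.ideal, ((x : A), q.map x) ∈ G) ∧ mk q ∈ centralInvariants R H A := by
  have hex : ∀ x : (hs.dense _ hd).ideal, ∃ y, ((x : A), y) ∈ G := fun x => mem_domain.1 x.2
  choose φ hφ using hex
  have uniq : ∀ {x y z : A}, (x, y) ∈ G → (x, z) ∈ G → y = z := fun {x y z} hy hz =>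
    sub_eq_zero.1 (h0 _ (by simpa using G.sub_mem hy hz))
  let q : PartialHom R H A :=
    { dom := hs.dense _ hd
      map :=
        { toFun := φ
          map_add' := fun x y => uniq (hφ (x + y)) (G.add_mem (hφ x) (hφ y))
          map_smul' := fun r x => uniq (hφ (r • x)) (by
            have := G.smul_mem (leftMul R H (r • (1 : A))) (hφ x)
            simpa using this) }
      map_mul := fun x a => uniq (hφ _) (G.smul_mem (rightMul R H a) (hφ x)) }
  refine ⟨q, fun x => mem_domain, hφ, (mk_mem_centralInvariants q).2 ⟨fun a x => ?_, fun h x => ?_⟩⟩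
  · exact uniq (hφ _) (G.smul_mem (leftMul R H a) (hφ x))
  · exact uniq (hφ _) (G.smul_mem (hopfAct R A h) (hφ x))

/-- Every functional relation is contained in the graph of a central invariant. -/
theorem exists_centralInvariant (hA : IsHSemiprime R H A) (hs : AnnihilatorSymmetric R H A)
    (G : Submodule (multiplicationRing R H A) (A × A)) (h0 : ∀ z, (0, z) ∈ G → z = 0) :
    ∃ c : centralInvariants R H A, ∀ y z, (y, z) ∈ G → c * lam R H A y = lam R H A z := by
  -- Extension by zero on `ann (domain G)`. It stays functional because this annihilator meets
  -- `domain G` trivially, and the enlarged domain has zero annihilator for the same kind of reason.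
  let G' := G ⊔ (ann (domain G)).prod ⊥
  have h0' : ∀ z, (0, z) ∈ G' → z = 0 := by
    intro z hz
    obtain ⟨⟨x, y⟩, hxy, ⟨n, k⟩, ⟨hn, hk⟩, e⟩ := Submodule.mem_sup.1 hz
    obtain ⟨e1, e2⟩ := Prod.mk.inj e
    have hk : k = 0 := hk
    have hx : x = 0 := hA.eq_zero_of_mem_ann (mem_domain.2 ⟨y, hxy⟩)
      (by
        have e3 : x = -n := eq_neg_of_add_eq_zero_left e1
        rw [e3]; exact neg_mem hn)
    subst hx
    rw [← e2, hk, add_zero, h0 y hxy]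
  have hd : ann (domain G') = ⊥ := by
    refine (Submodule.eq_bot_iff _).2 fun a ha => ?_
    have h1 : a ∈ ann (domain G) := fun x hx => ha x (Submodule.map_mono le_sup_left hx)
    refine hA.eq_zero_of_mem_ann h1 fun x hx => ha x (mem_domain.2 ⟨0, ?_⟩)
    exact le_sup_right (a := G) (show (x, (0 : A)) ∈ (ann (domain G)).prod ⊥ from ⟨hx, rfl⟩)
  obtain ⟨q, hq, hqG, hqc⟩ := exists_partialHom hs G' h0' hd
  refine ⟨⟨_, hqc⟩, fun y z hyz => ?_⟩
  have hyz' : (y, z) ∈ G' := le_sup_left (b := (ann (domain G)).prod ⊥) hyz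
  have hy := (hq y).2 ⟨z, hyz'⟩
  refine (mk_mul_lam q hy).trans (congrArg _ (sub_eq_zero.1 (h0' _ ?_)))
  simpa using G'.sub_mem (hqG ⟨y, hy⟩) hyz'

/-! ### Regularity and self-injectivity of the ring of central invariants. -/

theorem mul_comm_of_mem {c : MartindaleQuotient R H A} (hc : c ∈ centralInvariants R H A)
    (q : MartindaleQuotient R H A) : c * q = q * c :=
  (Subring.mem_center_iff.1 hc.1 q).symm

/-- Multiplication by `c` is injective on the annihilator of its kernel `K`. A central invariant `b`
inverting it there satisfies `c * b * c = c` both on `K` and on the part of `ann K` inside the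
domain of `c`, which together suffice for density. -/
theorem isVonNeumannRegular (hA : IsHSemiprime R H A) (hs : AnnihilatorSymmetric R H A) :
    IsVonNeumannRegular (centralInvariants R H A) := by
  rintro ⟨c, hc⟩
  let K : Submodule (multiplicationRing R H A) A :=
    (graph hc).comap (LinearMap.inl (multiplicationRing R H A) A A)
  have hK : ∀ {x}, x ∈ K ↔ c * lam R H A x = 0 := fun {x} => by
    rw [← map_zero (lam R H A)]; exact Iff.rfl
  -- The graph of `c` with its coordinates swapped, restricted to values in `ann K`.
  let G : Submodule (multiplicationRing R H A) (A × A) :=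
    (graph hc).comap (LinearMap.prod (LinearMap.snd _ A A) (LinearMap.fst _ A A)) ⊓
      (ann K).comap (LinearMap.snd _ A A)
  have hG : ∀ {y z}, (y, z) ∈ G ↔ c * lam R H A z = lam R H A y ∧ z ∈ ann K := Iff.rfl
  obtain ⟨⟨b, hb⟩, hbG⟩ := exists_centralInvariant hA hs G fun z hz => by
    have := hG.1 hz
    rw [map_zero] at this
    exact hA.eq_zero_of_mem_ann (hK.2 this.1) this.2
  refine ⟨⟨b, hb⟩, Subtype.ext ?_⟩
  change c * b * c = c
  have hd : c * b * c - c ∈ centralInvariants R H A :=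
    sub_mem (mul_mem (mul_mem hc hb) hc) hc
  let V : Submodule (multiplicationRing R H A) A :=
    (graph hd).comap (LinearMap.inl (multiplicationRing R H A) A A)
  have hV : ∀ {x}, x ∈ V ↔ (c * b * c - c) * lam R H A x = 0 := fun {x} => by
    rw [← map_zero (lam R H A)]; exact Iff.rfl
  obtain ⟨g, rfl⟩ := mk_surjective c
  have hVbot : ann V = ⊥ := by
    have h1 : ∀ x ∈ K, x ∈ V := fun x hx => hV.2 (by
      rw [sub_mul, mul_assoc, hK.1 hx, mul_zero, sub_zero])
    have h2 : ∀ x ∈ ann K, x ∈ g.dom.ideal → x ∈ V := fun x hx hx' => hV.2 (by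
      have e := mk_mul_lam g hx'
      have e' := hbG _ _ (hG.2 ⟨e, hx⟩)
      rw [sub_mul, mul_assoc, e, mul_assoc, e', e, sub_self])
    refine (Submodule.eq_bot_iff _).2 fun a ha => g.dom.left_annihilator a fun x hx => ?_
    have hax : a * x ∈ ann V := (ann V).smul_mem (rightMul R H x) ha
    refine hA.eq_zero_of_mem_ann (h2 _ (fun y hy => hax y (h1 y hy)) ?_) hax
    exact (g.dom.isIdeal a x hx).1
  exact sub_eq_zero.1 (eq_zero_of_mul_lam _ (hs.dense V hVbot) fun x hx => hV.1 hx)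

/-- By Baer's criterion, `φ` must be multiplication by some `q`. Where `e ∈ I` acts as the identity
on `y`, such a `q` must send `y` to `φ e * y`; these forced values form a functional relation. -/
theorem injective_centralInvariants (hA : IsHSemiprime R H A) (hs : AnnihilatorSymmetric R H A) :
    Module.Injective (centralInvariants R H A) (centralInvariants R H A) := by
  refine Module.Baer.injective fun I φ => ?_
  have comm : ∀ x y : centralInvariants R H A, x * y = y * x := fun x y =>
    Subtype.ext (mul_comm_of_mem x.2 y)
  have hφ : ∀ a b : I, φ a * (b : centralInvariants R H A) = φ b * a := fun a b => by
    rw [comm (φ a), comm (φ b), ← smul_eq_mul, ← map_smul, ← smul_eq_mul, ← map_smul]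
    exact congrArg φ (Subtype.ext (comm _ _))
  have hφ' : ∀ a b : I, ((φ a : MartindaleQuotient R H A)) * (b : centralInvariants R H A) =
    φ b * (a : centralInvariants R H A) := fun a b => congrArg Subtype.val (hφ a b)
  let G : Submodule (multiplicationRing R H A) (A × A) :=
    { carrier := {p | ∃ e : I, (e : centralInvariants R H A) * lam R H A p.1 = lam R H A p.1 ∧
        φ e * lam R H A p.1 = lam R H A p.2}
      add_mem' := by
        rintro ⟨y, z⟩ ⟨y', z'⟩ ⟨e, he, hez⟩ ⟨e', he', hez'⟩
        have c1 := mul_comm_of_mem (e : centralInvariants R H A).2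
        -- Since `1 - (e + e' - e e') = (1 - e) (1 - e')`, this element fixes both `y` and `y'`.
        -- Idempotence of `e` and `e'` is not needed.
        refine ⟨e + e' - (e : centralInvariants R H A) • e', ?_, ?_⟩
        · change ((e : centralInvariants R H A) + (e' : centralInvariants R H A) -
            (e : centralInvariants R H A) * (e' : centralInvariants R H A) :
              MartindaleQuotient R H A) * lam R H A (y + y') = lam R H A (y + y')
          have h1 : (e : centralInvariants R H A) * (e' : centralInvariants R H A) * lam R H A y =
              ((e' : centralInvariants R H A) : MartindaleQuotient R H A) * lam R H A y := by
            rw [c1, mul_assoc, he]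
          have h2 : (e : centralInvariants R H A) * (e' : centralInvariants R H A) *
              lam R H A y' =
              ((e : centralInvariants R H A) : MartindaleQuotient R H A) * lam R H A y' := by
            rw [mul_assoc, he']
          rw [map_add, sub_mul, mul_add (_ * _), h1, h2, add_mul, mul_add, mul_add, he, he']
          abel
        · have hsub : φ (e + e' - (e : centralInvariants R H A) • e') =
              φ e + φ e' - (e : centralInvariants R H A) * φ e' := by
            rw [map_sub, map_add, map_smul, smul_eq_mul]
          rw [hsub]
          change (φ e + φ e' - (e : centralInvariants R H A) * φ e' :
              MartindaleQuotient R H A) * lam R H A (y + y') = lam R H A (z + z')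
          have h1 : (e : centralInvariants R H A) * φ e' * lam R H A y =
              (φ e' : MartindaleQuotient R H A) * lam R H A y := by
            rw [c1, mul_assoc, he]
          have h2 : (e : centralInvariants R H A) * φ e' * lam R H A y' =
              (φ e : MartindaleQuotient R H A) * lam R H A y' := by
            rw [c1, ← hφ', mul_assoc, he']
          rw [map_add, map_add, sub_mul, mul_add (_ * _), h1, h2, add_mul, mul_add, mul_add, hez,
            hez']
          abel
      zero_mem' := ⟨0, by simp, by simp⟩
      smul_mem' := fun m p ⟨e, h1, h2⟩ =>
        ⟨e, mul_lam_smul (e : centralInvariants R H A).2 m h1, mul_lam_smul (φ e).2 m h2⟩ }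
  have hG : ∀ {y z}, (y, z) ∈ G ↔ ∃ e : I,
      (e : centralInvariants R H A) * lam R H A y = lam R H A y ∧
        φ e * lam R H A y = lam R H A z := Iff.rfl
  obtain ⟨q, hq⟩ := exists_centralInvariant hA hs G fun z hz => by
    obtain ⟨e, -, h⟩ := hG.1 hz
    rw [map_zero, mul_zero] at h
    exact lam_injective (h.symm.trans (map_zero _).symm)
  refine ⟨LinearMap.toSpanSingleton _ _ q, fun a ha => ?_⟩
  rw [LinearMap.toSpanSingleton_apply, smul_eq_mul]
  refine Subtype.ext (sub_eq_zero.1 ?_)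
  obtain ⟨b, hb⟩ := isVonNeumannRegular hA hs a
  -- Regularity provides an element of `I` that fixes `a`, so the pairs `(a x, φ a x)` belong to
  -- `G`.
  let e : I := ⟨b * a, I.mul_mem_left b ha⟩
  have hea : ((e : centralInvariants R H A) : MartindaleQuotient R H A) * a = a := by
    have : b * a * a = a := by rw [comm b a, mul_assoc, comm b a, comm, hb]
    exact congrArg Subtype.val this
  have hφe : (φ e : MartindaleQuotient R H A) * a = φ ⟨a, ha⟩ := by
    rw [hφ' e ⟨a, ha⟩, mul_comm_of_mem (φ ⟨a, ha⟩).2]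
    have : (e : centralInvariants R H A) * φ ⟨a, ha⟩ = φ ⟨a, ha⟩ := by
      rw [← smul_eq_mul, ← map_smul]
      exact congrArg φ (Subtype.ext (Subtype.ext hea))
    exact congrArg Subtype.val this
  obtain ⟨g, hg⟩ := mk_surjective (a : MartindaleQuotient R H A)
  obtain ⟨p, hp⟩ := mk_surjective (φ ⟨a, ha⟩ : MartindaleQuotient R H A)
  refine eq_zero_of_mul_lam _ (g.dom.inf p.dom) fun x hx => ?_
  have hgx := mk_mul_lam g hx.1
  have hpx := mk_mul_lam p hx.2
  rw [hg] at hgx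
  rw [hp] at hpx
  have hq := hq _ (p.map ⟨x, hx.2⟩) (hG.2 ⟨e, by rw [← hgx, ← mul_assoc, hea],
    by rw [← hgx, ← mul_assoc, hφe]; exact hpx⟩)
  change (a * q - φ ⟨a, ha⟩ : MartindaleQuotient R H A) * _ = 0
  rw [mul_comm_of_mem a.2, sub_mul, mul_assoc, hgx, hq]
  exact sub_eq_zero.2 hpx.symm

end MartindaleQuotient

end Martindale

/-! ### Injective and self-injective hulls over an arbitrary ring. -/

section InjectiveHull

variable {S : Type*} [Ring S] {M E : Type u} [AddCommGroup M] [Module S M]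
  [AddCommGroup E] [Module S E]

theorem toSelfInjectiveHull_injective {ι : M →ₗ[S] E} (hι : IsInjectiveHull ι) :
    Function.Injective (toSelfInjectiveHull ι) :=
  fun _ _ h => hι.injective (congrArg Subtype.val h)

/-- A map into an injective hull vanishes on a submodule if its image there meets the given module
trivially. -/
theorem IsInjectiveHull.eq_zero_of_meet {ι : M →ₗ[S] E} (hι : IsInjectiveHull ι) {X : Type*}
    [AddCommGroup X] [Module S X] (f : X →ₗ[S] E) (N : Submodule S X)
    (h : ∀ x ∈ N, ∀ a, f x = ι a → f x = 0) : ∀ x ∈ N, f x = 0 := by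
  have := hι.essential (N.map f) ((Submodule.eq_bot_iff _).2 (by
    rintro _ ⟨⟨x, hx, rfl⟩, ⟨a, ha⟩⟩
    exact h x hx a ha.symm))
  intro x hx
  exact (Submodule.eq_bot_iff _).1 this _ ⟨x, hx, rfl⟩

/-- Every map from a submodule of `M` to its injective hull extends to an endomorphism of the
self-injective hull. -/
theorem IsInjectiveHull.exists_extension {ι : M →ₗ[S] E} (hι : IsInjectiveHull ι)
    (N : Submodule S M) (g : N →ₗ[S] E) :
    ∃ f : Module.End S (selfInjectiveHull S M E),
      ∀ x : N, (f (toSelfInjectiveHull ι x) : E) = g x := by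
  obtain ⟨k, hk⟩ := hι.injective_module.out (ι ∘ₗ N.subtype)
    (hι.injective.comp N.injective_subtype) g
  -- The hull is the sum of the images of all maps `u : M → E`, and `k ∘ u` is again such a map.
  have hmaps : ∀ x ∈ selfInjectiveHull S M E, k x ∈ selfInjectiveHull S M E := by
    intro x hx
    refine (show selfInjectiveHull S M E ≤ (selfInjectiveHull S M E).comap k from
      iSup_le fun u => ?_) hx
    rintro _ ⟨m, rfl⟩
    exact Submodule.mem_iSup_of_mem (k ∘ₗ u) ⟨m, rfl⟩
  exact ⟨k.restrict hmaps, hk⟩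

end InjectiveHull

/-! ### Endomorphisms of the self-injective hull. -/

section Endomorphisms

variable {R : Type w} [CommRing R] {H : Type v} [Ring H] [HopfAlgebra R H]
  {A : Type u} [Ring A] [Algebra R A] [Module H A] [IsScalarTower R H A]
  {E : Type u} [AddCommGroup E] [Module (multiplicationRing R H A) E]

attribute [local instance] multiplicationModule

open MartindaleQuotient

/-- The relation `f x = a` on `A` given by an endomorphism `f` of the self-injective hull. -/
def endGraph (ι : A →ₗ[multiplicationRing R H A] E)
    (f : Module.End (multiplicationRing R H A) (selfInjectiveHull (multiplicationRing R H A) A E)) :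
    Submodule (multiplicationRing R H A) (A × A) :=
  LinearMap.eqLocus (f ∘ₗ toSelfInjectiveHull ι ∘ₗ LinearMap.fst _ A A)
    (toSelfInjectiveHull ι ∘ₗ LinearMap.snd _ A A)

theorem mem_endGraph {ι : A →ₗ[multiplicationRing R H A] E}
    {f : Module.End (multiplicationRing R H A) (selfInjectiveHull (multiplicationRing R H A) A E)}
    {x a : A} : (x, a) ∈ endGraph ι f ↔ f (toSelfInjectiveHull ι x) = toSelfInjectiveHull ι a :=
  Iff.rfl

variable [HopfModuleAlgebra R H A]

/-- Let D be the domain. On `ann D`, the map f takes a value in `A` only at points of D, hence only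
at 0. Essentiality makes f vanish on `ann D`, which places `ann D` inside D, so it is zero. -/
theorem ann_domain_endGraph (hA : IsHSemiprime R H A) {ι : A →ₗ[multiplicationRing R H A] E}
    (hι : IsInjectiveHull ι)
    (f : Module.End (multiplicationRing R H A) (selfInjectiveHull (multiplicationRing R H A) A E)) :
    ann (domain (endGraph ι f)) = ⊥ := by
  have key := hι.eq_zero_of_meet
    ((selfInjectiveHull (multiplicationRing R H A) A E).subtype ∘ₗ f ∘ₗ toSelfInjectiveHull ι)
    (ann (domain (endGraph ι f))) (fun x hx a ha => by
      have hxa : (x, a) ∈ endGraph ι f := mem_endGraph.2 (Subtype.ext ha)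
      rw [hA.eq_zero_of_mem_ann (mem_domain.2 ⟨a, hxa⟩) hx, map_zero])
  refine (Submodule.eq_bot_iff _).2 fun x hx => ?_
  refine hA.eq_zero_of_mem_ann (mem_domain.2 ⟨0, mem_endGraph.2 ?_⟩) hx
  rw [map_zero]
  exact Subtype.ext (key x hx)

/-- An endomorphism of the self-injective hull that vanishes on a dense ideal is zero. -/
theorem end_eq_zero (hA : IsHSemiprime R H A) {ι : A →ₗ[multiplicationRing R H A] E}
    (hι : IsInjectiveHull ι)
    (f : Module.End (multiplicationRing R H A) (selfInjectiveHull (multiplicationRing R H A) A E))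
    (N : Submodule (multiplicationRing R H A) A) (hN : ann N = ⊥)
    (hf : ∀ x ∈ N, f (toSelfInjectiveHull ι x) = 0) : f = 0 := by
  -- The images of the maps `u` generate the hull.
  suffices h : ∀ (u : A →ₗ[multiplicationRing R H A] E) (a : A)
      (hu : u a ∈ selfInjectiveHull (multiplicationRing R H A) A E), f ⟨u a, hu⟩ = 0 by
    ext ⟨x, hx⟩
    have hle : selfInjectiveHull (multiplicationRing R H A) A E ≤
        (LinearMap.ker f).map (Submodule.subtype _) := iSup_le fun u => by
      rintro _ ⟨a, rfl⟩
      exact ⟨⟨u a, Submodule.mem_iSup_of_mem u ⟨a, rfl⟩⟩, h u a _, rfl⟩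
    obtain ⟨y, hy, rfl⟩ := hle hx
    exact congrArg Subtype.val hy
  intro u
  let u' : A →ₗ[multiplicationRing R H A] selfInjectiveHull (multiplicationRing R H A) A E :=
    u.codRestrict _ fun a => Submodule.mem_iSup_of_mem u ⟨a, rfl⟩
  let K : Submodule (multiplicationRing R H A) A := (N.map ι).comap u
  have hfK : ∀ x ∈ K, f (u' x) = 0 := by
    rintro x ⟨n, hn, hx⟩
    rw [← hf n hn]
    exact congrArg f (Subtype.ext hx.symm)
  -- If `x ∈ ann K` and `u x = ι a`, then `u (x n) = ι (a n)` for `n ∈ N`, so `x n` lies in `K` and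
  -- in `ann K`. Thus `x ∈ ann N = ⊥`. By essentiality `u` kills `ann K`, whence `ann K ≤ K`.
  have hK : ann K = ⊥ := by
    have hu := hι.eq_zero_of_meet u (ann K) (fun x hx a ha => by
      have : x ∈ ann N := fun n hn => by
        refine hA.eq_zero_of_mem_ann (N := K) ⟨a * n, N.smul_mem (leftMul R H a) hn, ?_⟩
          ((ann K).smul_mem (rightMul R H n) hx)
        have e := map_smul u (rightMul R H n) x
        rw [ha, ← map_smul] at e
        exact e.symm
      rw [hN, Submodule.mem_bot] at this
      rw [this, map_zero])
    refine (Submodule.eq_bot_iff _).2 fun x hx => ?_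
    exact hA.eq_zero_of_mem_ann (N := K) ⟨0, N.zero_mem, by rw [hu x hx, map_zero]⟩ hx
  intro a ha
  -- If `f (u x) = ι b`, then `ι (b k) = f (u (x k)) = 0` for all `k ∈ K`, so `b ∈ ann K = ⊥`.
  refine Subtype.ext (hι.eq_zero_of_meet (Submodule.subtype _ ∘ₗ f ∘ₗ u') ⊤ ?_ a trivial)
  intro x _ b hb
  have : b ∈ ann K := fun k hk => by
    refine hι.injective ?_
    have e := map_smul ι (rightMul R H k) b
    rw [← hb, ← map_smul] at e
    rw [map_zero]
    exact e.trans (congrArg Subtype.val (hfK _ (K.smul_mem (leftMul R H x) hk)))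
  rw [hK, Submodule.mem_bot] at this
  rw [hb, this, map_zero]

/-- A partial map that represents a central invariant is linear over the multiplication ring. -/
def linearMapOfMem (p : PartialHom R H A) (hc : mk p ∈ centralInvariants R H A) :
    ofIdeal p.dom.ideal p.dom.isIdeal p.dom.isStable →ₗ[multiplicationRing R H A] A where
  toFun x := p.map ⟨x, x.2⟩
  map_add' x y := map_add p.map ⟨x, x.2⟩ ⟨y, y.2⟩
  map_smul' m x := lam_injective (R := R) (H := H)
    ((mk_mul_lam p (m • x).2).symm.trans (mul_lam_smul hc m (mk_mul_lam p x.2)))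

/-- The endomorphism ring of the self-injective hull is the ring of central invariants. -/
theorem exists_end_ringEquiv (hA : IsHSemiprime R H A) (hs : AnnihilatorSymmetric R H A)
    {ι : A →ₗ[multiplicationRing R H A] E} (hι : IsInjectiveHull ι) :
    ∃ ψ : Module.End (multiplicationRing R H A)
        (selfInjectiveHull (multiplicationRing R H A) A E) ≃+* centralInvariants R H A,
      ∀ f, ∃ q : PartialHom R H A,
        (∀ x : A, x ∈ q.dom.ideal ↔
          ∃ a : A, f (toSelfInjectiveHull ι x) = toSelfInjectiveHull ι a) ∧
        (∀ x : q.dom.ideal, toSelfInjectiveHull ι (q.map x) = f (toSelfInjectiveHull ι (x : A))) ∧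
        (ψ f : MartindaleQuotient R H A) = mk q := by
  have hj := toSelfInjectiveHull_injective hι
  have hex : ∀ f : Module.End (multiplicationRing R H A)
      (selfInjectiveHull (multiplicationRing R H A) A E), ∃ q : PartialHom R H A,
        (∀ x : A, x ∈ q.dom.ideal ↔
          ∃ a : A, f (toSelfInjectiveHull ι x) = toSelfInjectiveHull ι a) ∧
        (∀ x : q.dom.ideal, toSelfInjectiveHull ι (q.map x) = f (toSelfInjectiveHull ι (x : A))) ∧
        mk q ∈ centralInvariants R H A := by
    intro f
    obtain ⟨q, h1, h2, h3⟩ := exists_partialHom hs (endGraph ι f) (fun z hz => by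
      have := mem_endGraph.1 hz
      rw [map_zero, map_zero] at this
      exact hj (this.symm.trans (map_zero _).symm)) (ann_domain_endGraph hA hι f)
    exact ⟨q, h1, fun x => (mem_endGraph.1 (h2 x)).symm, h3⟩
  choose q hdom hmap hmem using hex
  -- Any partial map compatible with `f` represents its class, whatever its domain. The ring
  -- homomorphism laws and surjectivity all reduce to this.
  have uniq : ∀ f (p : PartialHom R H A), (∀ x : p.dom.ideal,
      toSelfInjectiveHull ι (p.map x) = f (toSelfInjectiveHull ι (x : A))) → mk (q f) = mk p :=
    fun f p hp => mk_eq_of fun x hx hx' => hj ((hmap f ⟨x, hx⟩).trans (hp ⟨x, hx'⟩).symm)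
  let ψ : Module.End (multiplicationRing R H A)
      (selfInjectiveHull (multiplicationRing R H A) A E) →+* centralInvariants R H A :=
    { toFun := fun f => ⟨mk (q f), hmem f⟩
      map_one' := Subtype.ext (uniq 1 (PartialHom.one R H A) fun _ => rfl)
      map_zero' := Subtype.ext (uniq 0 (PartialHom.zero R H A) fun _ => map_zero _)
      map_add' := fun f g => Subtype.ext (uniq (f + g) ((q f).add (q g)) fun x => by
        refine (map_add (toSelfInjectiveHull ι) ((q f).map ⟨x, x.2.1⟩)
          ((q g).map ⟨x, x.2.2⟩)).trans ?_
        rw [hmap, hmap]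
        rfl)
      map_mul' := fun f g => Subtype.ext (uniq (f * g) ((q f).mul (q g)) fun x => by
        refine (hmap f ⟨_, PartialHom.map_mem_dom (q f) (q g) x x.2⟩).trans ?_
        exact congrArg f (hmap g ⟨x, PartialHom.mul_le_dom (q f) (q g) x.2⟩)) }
  refine ⟨RingEquiv.ofBijective ψ ⟨(injective_iff_map_eq_zero ψ).2 fun f hf => ?_, ?_⟩,
    fun f => ⟨q f, hdom f, hmap f, rfl⟩⟩
  · have hrel := mk_eq_iff.1 (show mk (q f) = mk (PartialHom.zero R H A) from
      congrArg Subtype.val hf)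
    refine end_eq_zero hA hι f _ (ann_domain_endGraph hA hι f) fun x hx => ?_
    have hx' := (hdom f x).2 (mem_domain.1 hx)
    rw [← hmap f ⟨x, hx'⟩, hrel.eq x hx' trivial]
    exact map_zero _
  · rintro ⟨c, hc⟩
    obtain ⟨p, rfl⟩ := mk_surjective c
    obtain ⟨f, hf⟩ := hι.exists_extension _ (ι ∘ₗ linearMapOfMem p hc)
    exact ⟨f, Subtype.ext (uniq f p fun x => Subtype.ext (hf x).symm)⟩

end Endomorphisms

end HopfAction

end

/-- The claim that I_f belongs to the filter is carried by `q`: its domain is a `StableDenseIdeal`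
whose elements are exactly those of I_f. -/
theorem mainTheorem3 {R : Type w} [CommRing R] {H : Type v} [Ring H] [HopfAlgebra R H]
    {A : Type u} [Ring A] [Algebra R A] [Module H A] [IsScalarTower R H A]
    [HopfAction.HopfModuleAlgebra R H A]
    (hA : HopfAction.IsHSemiprime R H A)
    (hyp : (∀ a b : A, a * b = b * a) ∨ HopfAction.IsSemiprimeAlgebra R A ∨
      Function.Bijective (HopfAlgebra.antipode R : H →ₗ[R] H)) :
    (∀ (E : Type u) [AddCommGroup E] [Module (HopfAction.multiplicationRing R H A) E]
        (ι : A →ₗ[HopfAction.multiplicationRing R H A] E), HopfAction.IsInjectiveHull ι →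
      ∃ ψ : Module.End (HopfAction.multiplicationRing R H A)
            (HopfAction.selfInjectiveHull (HopfAction.multiplicationRing R H A) A E) ≃+*
          HopfAction.MartindaleQuotient.centralInvariants R H A,
        ∀ f, ∃ q : HopfAction.PartialHom R H A,
          (∀ x : A, x ∈ q.dom.ideal ↔
            ∃ a : A, f (HopfAction.toSelfInjectiveHull ι x) = HopfAction.toSelfInjectiveHull ι a) ∧
          (∀ x : q.dom.ideal, HopfAction.toSelfInjectiveHull ι (q.map x) =
            f (HopfAction.toSelfInjectiveHull ι (x : A))) ∧
          (ψ f : HopfAction.MartindaleQuotient R H A) = HopfAction.MartindaleQuotient.mk q) ∧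
    HopfAction.IsVonNeumannRegular (HopfAction.MartindaleQuotient.centralInvariants R H A) ∧
    Module.Injective (HopfAction.MartindaleQuotient.centralInvariants R H A)
      (HopfAction.MartindaleQuotient.centralInvariants R H A) := by
  have hs := HopfAction.annihilatorSymmetric hA hyp
  exact ⟨fun E _ _ ι hι => HopfAction.exists_end_ringEquiv hA hs hι,
    HopfAction.MartindaleQuotient.isVonNeumannRegular hA hs,
    HopfAction.MartindaleQuotient.injective_centralInvariants hA hs⟩
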